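/- Let $\mathrm{Ch}^b(\mathbb Z)$ be the symmetric monoidal exact category of bounded (cohomological) complexes of finitely generated free abelian groups, with the usual tensor product and the degreewise split conflations. Its unit $\mathbf 1$ is $\mathbb Z$ in degree $0$; let $C$ be the complex $\mathbb Z\xrightarrow{\ \mathrm{id}\ }\mathbb Z$ in degrees $-1,0$. Let $\mathcal E$ be a complicial exact category, that is, a (Quillen) exact category equipped with a bi-exact action $\otimes:\mathrm{Ch}^b(\mathbb Z)\times\mathcal E\to\mathcal E$ of this monoidal category. Write $Cx=C\otimes x$; the inclusion $\mathbf 1\to C$ induces an inflation $x\to Cx$. For $f:x\to y$, let $\mathrm{Cone}(f)$ be the pushout of $f$ along $x\to Cx$. A Frobenius inflation is an inflation $x\to y$ along which every map $x\to Cu$ ($u\in\mathcal E$) extends to $y$; a Frobenius deflation is a deflation $x\to y$ along which every map $Cu\to y$ lifts to $x$. An object is projective-injective if it is projective with respect to Frobenius deflations and injective with respect to Frobenius inflations. Two parallel maps are homotopic if their difference factors through a projective-injective object; a map is a homotopy equivalence if it has an inverse up to homotopy. A *class of weak equivalences* is a class $w$ of morphisms of $\mathcal E$ such that * if $f$ is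 a (chain) homotopy equivalence in $\mathrm{Ch}^b(\mathbb Z)$ and $g\in w$, then $f\otimes g\in w$; * every homotopy equivalence of $\mathcal E$ is in $w$; * $w$ has the two-out-of-three property; * if $(a,b,c)$ is a morphism of conflations with $a,c\in w$, then $b\in w$; * $w$ is closed under retracts in the arrow category. A *null class* is an additive full subcategory $\mathcal N$ of $\mathcal E$ (containing $0$ and closed under finite direct sums) such that * every object homotopy equivalent to an object of $\mathcal N$ is in $\mathcal N$; * $a\otimes x\in\mathcal N$ for all $a\in\mathrm{Ch}^b(\mathbb Z)$ and $x\in\mathcal N$; * if $x\to y\to z$ is a conflation in $\mathcal E$ and $x,z\in\mathcal N$, then $y\in\mathcal N$; * if $i:x\to y$, $p:y\to x$ satisfy $pi=\mathrm{id}_x$ and $y\in\mathcal N$, then $x\in\mathcal N$. For a class of weak equivalences $w$ let $\mathcal E^w$ be the class of $w$-trivial objects, i.e. of those $x$ for which $0\to x$ is in $w$. For a null class $\mathcal N$ let $w_{\mathcal N}=\{f\mid \mathrm{Cone}(f)\in\mathcal N\}$. Then: 1. for every class of weak equivalences $w$, $\mathcal E^w$ is a null class; 2. for every null class $\mathcal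 N$, $w_{\mathcal N}$ is a class of weak equivalences; 3. $w\mapsto\mathcal E^w$ and $\mathcal N\mapsto w_{\mathcal N}$ are mutually inverse bijections between the classes of weak equivalences and the null classes of $\mathcal E$: $w_{\mathcal E^w}=w$ and $\mathcal E^{w_{\mathcal N}}=\mathcal N$. -/

import Mathlib

open CategoryTheory Limits MonoidalCategory ZeroObject

noncomputable section

namespace Complicial

instance curriedTensor_obj_preserves (X : ModuleCat.{0} ℤ) :
    PreservesColimitsOfSize.{0, 0} ((curriedTensor (ModuleCat.{0} ℤ)).obj X) :=
  inferInstanceAs (PreservesColimitsOfSize.{0, 0} (tensorLeft X))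

instance curriedTensor_flip_obj_preserves (X : ModuleCat.{0} ℤ) :
    PreservesColimitsOfSize.{0, 0} ((curriedTensor (ModuleCat.{0} ℤ)).flip.obj X) :=
  preservesColimits_of_natIso (BraidedCategory.tensorLeftIsoTensorRight X)

/-- Finitely generated free modules. -/
def IsFreeFinite {R : Type} [CommRing R] (M : ModuleCat.{0} R) : Prop :=
  Module.Free R M ∧ Module.Finite R M

theorem isFreeFinite_of_retract {R : Type} [CommRing R] [IsDomain R] [IsPrincipalIdealRing R]
    {M N : ModuleCat.{0} R} (r : M ⟶ N) (t : N ⟶ M)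
    (h : r ≫ t = 𝟙 M) (hN : IsFreeFinite N) : IsFreeFinite M := by
  obtain ⟨_, _⟩ := hN
  have hl : t.hom ∘ₗ r.hom = LinearMap.id := by
    rw [← ModuleCat.hom_comp, h, ModuleCat.hom_id]
  have : Module.Finite R M := Module.Finite.of_surjective t.hom
    (fun x => ⟨r.hom x, LinearMap.congr_fun hl x⟩)
  have : Module.Free R M := Module.Free.of_equiv
    (LinearEquiv.ofInjective r.hom (fun x y hxy => by
      rw [← LinearMap.id_apply (R := R) x, ← LinearMap.id_apply (R := R) y, ← hl]
      simp [hxy])).symm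
  exact ⟨inferInstance, inferInstance⟩

theorem isFreeFinite_tensor {R : Type} [CommRing R] {M N : ModuleCat.{0} R}
    (hM : IsFreeFinite M) (hN : IsFreeFinite N) : IsFreeFinite (M ⊗ N) := by
  obtain ⟨_, _⟩ := hM
  obtain ⟨_, _⟩ := hN
  exact ⟨inferInstanceAs (Module.Free R (TensorProduct R M N)),
    inferInstanceAs (Module.Finite R (TensorProduct R M N))⟩

theorem isFreeFinite_biproduct {R : Type} [CommRing R] [IsDomain R] [IsPrincipalIdealRing R]
    {ι : Type} [Fintype ι]
    (f : ι → ModuleCat.{0} R) (hf : ∀ i, IsFreeFinite (f i)) :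
    IsFreeFinite (⨁ f : ModuleCat.{0} R) := by
  have := fun i => (hf i).1
  have := fun i => (hf i).2
  exact isFreeFinite_of_retract (ModuleCat.biproductIsoPi f).hom (ModuleCat.biproductIsoPi f).inv
    (by simp) ⟨inferInstanceAs (Module.Free R (∀ i, f i)),
      inferInstanceAs (Module.Finite R (∀ i, f i))⟩

theorem isFreeFinite_int : IsFreeFinite (ModuleCat.of ℤ ℤ) :=
  ⟨inferInstanceAs (Module.Free ℤ ℤ), inferInstanceAs (Module.Finite ℤ ℤ)⟩

/-- Bounded complexes of finitely generated free abelian groups (cohomological grading). -/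
def boundedFree : ObjectProperty (CochainComplex (ModuleCat.{0} ℤ) ℤ) := fun K =>
  (∀ n, IsFreeFinite (K.X n)) ∧ ∃ a b : ℤ, ∀ n, n < a ∨ b < n → IsZero (K.X n)

theorem isZero_tensor {M N : ModuleCat.{0} ℤ} (h : IsZero M ∨ IsZero N) : IsZero (M ⊗ N) := by
  rw [IsZero.iff_id_eq_zero, ← id_whiskerRight]
  rcases h with h | h
  · rw [(IsZero.iff_id_eq_zero M).1 h, MonoidalPreadditive.zero_whiskerRight]
  · rw [id_whiskerRight, ← whiskerLeft_id, (IsZero.iff_id_eq_zero N).1 h, MonoidalPreadditive.whiskerLeft_zero]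

open Classical in
theorem boundedFree_tensor (K L : CochainComplex (ModuleCat.{0} ℤ) ℤ) (hK : boundedFree K)
    (hL : boundedFree L) : boundedFree (K ⊗ L) := by
  obtain ⟨hK, a, b, hab⟩ := hK
  obtain ⟨hL, c, d, hcd⟩ := hL
  refine ⟨fun n => ?_, a + c, b + d, fun n hn => ?_⟩
  · let s := Finset.Icc a b
    let f : s → ModuleCat.{0} ℤ := fun i => K.X i ⊗ L.X (n - i)
    have hf : ∀ i, IsFreeFinite (f i) := fun i => isFreeFinite_tensor (hK i) (hL (n - i))
    let r : (K ⊗ L).X n ⟶ ⨁ f := HomologicalComplex.mapBifunctorDesc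
      (fun i₁ i₂ (h : i₁ + i₂ = n) =>
        if hi : i₁ ∈ s then
          eqToHom (by obtain rfl : i₂ = n - i₁ := by omega
                      rfl) ≫ biproduct.ι f ⟨i₁, hi⟩
        else 0)
    let t : ⨁ f ⟶ (K ⊗ L).X n := biproduct.desc (fun i =>
      HomologicalComplex.ιTensorObj K L i (n - i) n (by omega))
    refine isFreeFinite_of_retract r t ?_ (isFreeFinite_biproduct f hf)
    refine HomologicalComplex.mapBifunctor.hom_ext (F := curriedTensor _) ?_
    intro i₁ i₂ (h : i₁ + i₂ = n)
    obtain rfl : i₂ = n - i₁ := by omega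
    by_cases hi : i₁ ∈ s
    · simp only [r, t, hi, f, HomologicalComplex.ι_mapBifunctorDesc_assoc, dif_pos, eqToHom_refl,
        Category.id_comp, biproduct.ι_desc]
      exact (Category.comp_id _).symm
    · refine (isZero_tensor (Or.inl (hab i₁ ?_))).eq_of_src _ _
      simp only [s, Finset.mem_Icc] at hi
      omega
  · rw [IsZero.iff_id_eq_zero]
    refine HomologicalComplex.mapBifunctor.hom_ext (F := curriedTensor _) ?_
    intro i₁ i₂ (h : i₁ + i₂ = n)
    refine (isZero_tensor ?_).eq_of_src _ _
    by_cases h1 : i₁ < a ∨ b < i₁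
    · exact Or.inl (hab _ h1)
    · exact Or.inr (hcd _ (by omega))

theorem boundedFree_single (n : ℤ) :
    boundedFree ((HomologicalComplex.single (ModuleCat.{0} ℤ) (.up ℤ) n).obj
      (ModuleCat.of ℤ ℤ)) := by
  have hz : ∀ i, i ≠ n → IsZero (((HomologicalComplex.single (ModuleCat.{0} ℤ) (.up ℤ) n).obj
      (ModuleCat.of ℤ ℤ)).X i) := fun i hi => HomologicalComplex.isZero_single_obj_X _ _ _ _ hi
  refine ⟨fun i => ?_, n, n, fun i hi => hz i (by omega)⟩
  refine isFreeFinite_of_retract (N := ModuleCat.of ℤ ℤ) ?_ ?_ ?_ isFreeFinite_int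
  · by_cases hi : i = n
    · exact (HomologicalComplex.singleObjXIsoOfEq _ _ _ _ hi).hom
    · exact 0
  · by_cases hi : i = n
    · exact (HomologicalComplex.singleObjXIsoOfEq _ _ _ _ hi).inv
    · exact 0
  · by_cases hi : i = n
    · simp [hi]
    · exact (hz i hi).eq_of_src _ _

instance : boundedFree.IsMonoidal where
  prop_unit := boundedFree_single 0
  prop_tensor K L hK hL := boundedFree_tensor K L hK hL

/-- The monoidal category of bounded complexes of finitely generated free abelian groups. -/
abbrev ChbZ := boundedFree.FullSubcategory

theorem up_rel : (ComplexShape.up ℤ).Rel (-1) 0 := by simp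

/-- The complex `C`: it is `ℤ` in degrees `-1` and `0`, with differential the identity. -/
def complexC : CochainComplex (ModuleCat.{0} ℤ) ℤ :=
  HomologicalComplex.double (𝟙 (ModuleCat.of ℤ ℤ)) up_rel

theorem complexC_d_zero (j : ℤ) : complexC.d 0 j = 0 :=
  HomologicalComplex.double_d_eq_zero₀ _ up_rel 0 j (by simp)

theorem complexC_d_neg_one (j : ℤ) : complexC.d j (-1) = 0 :=
  HomologicalComplex.double_d_eq_zero₁ _ up_rel j (-1) (by simp)

theorem isZero_complexC_X (i : ℤ) (h₀ : i ≠ -1) (h₁ : i ≠ 0) : IsZero (complexC.X i) :=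
  HomologicalComplex.isZero_double_X _ up_rel i h₀ h₁

theorem boundedFree_complexC : boundedFree complexC := by
  have hz := isZero_complexC_X
  refine ⟨fun i => ?_, -1, 0, fun i hi => hz i (by omega) (by omega)⟩
  refine isFreeFinite_of_retract (N := ModuleCat.of ℤ ℤ) ?_ ?_ ?_ isFreeFinite_int
  · by_cases hi : i = -1
    · subst hi; exact (HomologicalComplex.doubleXIso₀ _ up_rel).hom
    · by_cases hi : i = 0
      · subst hi; exact (HomologicalComplex.doubleXIso₁ _ up_rel (by simp)).hom
      · exact 0
  · by_cases hi : i = -1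
    · subst hi; exact (HomologicalComplex.doubleXIso₀ _ up_rel).inv
    · by_cases hi : i = 0
      · subst hi; exact (HomologicalComplex.doubleXIso₁ _ up_rel (by simp)).inv
      · exact 0
  · by_cases hi : i = -1
    · subst hi; simp [complexC]
    · by_cases hi' : i = 0
      · subst hi'; simp [complexC]
      · exact (hz i hi hi').eq_of_src _ _

/-- `C` as an object of `ChbZ`. -/
def C : ChbZ := ⟨complexC, boundedFree_complexC⟩

/-- `T` is `ℤ` in degree `-1` and zero elsewhere. -/
def T : ChbZ := ⟨(HomologicalComplex.single (ModuleCat.{0} ℤ) (.up ℤ) (-1)).obj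
  (ModuleCat.of ℤ ℤ), boundedFree_single (-1)⟩

/-- The degree `0` part of `C`. -/
def complexCXZero : complexC.X 0 ≅ ModuleCat.of ℤ ℤ :=
  HomologicalComplex.doubleXIso₁ (𝟙 (ModuleCat.of ℤ ℤ)) up_rel (by simp)

/-- The degree `-1` part of `C`. -/
def complexCXNegOne : complexC.X (-1) ≅ ModuleCat.of ℤ ℤ :=
  HomologicalComplex.doubleXIso₀ (𝟙 (ModuleCat.of ℤ ℤ)) up_rel

/-- The map from `ℤ` in degree `0` to `C`, the identity in degree `0`. -/
def singleToComplexC :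
    (HomologicalComplex.single (ModuleCat.{0} ℤ) (.up ℤ) 0).obj (ModuleCat.of ℤ ℤ) ⟶ complexC :=
  HomologicalComplex.mkHomFromSingle complexCXZero.inv
    (fun j _ => by rw [complexC_d_zero, comp_zero])

/-- The map from `C` to `ℤ` in degree `-1`, the identity in degree `-1`. -/
def complexCToSingle :
    complexC ⟶ (HomologicalComplex.single (ModuleCat.{0} ℤ) (.up ℤ) (-1)).obj (ModuleCat.of ℤ ℤ) :=
  HomologicalComplex.mkHomToSingle complexCXNegOne.hom
    (fun j _ => by rw [complexC_d_neg_one, zero_comp])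

theorem isIso_singleToComplexC_f : IsIso (singleToComplexC.f 0) := by
  rw [singleToComplexC, HomologicalComplex.mkHomFromSingle_f]
  infer_instance

theorem isIso_complexCToSingle_f : IsIso (complexCToSingle.f (-1)) := by
  rw [complexCToSingle, HomologicalComplex.mkHomToSingle_f]
  infer_instance

/-- The inclusion `𝟙 ⟶ C`, the identity of `ℤ` in degree `0`. -/
def unitToC : 𝟙_ ChbZ ⟶ C := ObjectProperty.homMk singleToComplexC

/-- The projection `C ⟶ T`, the identity of `ℤ` in degree `-1`. -/
def cToT : C ⟶ T := ObjectProperty.homMk complexCToSingle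

/-- The short complex `𝟙 ⟶ C ⟶ T`. -/
def unitCT : ShortComplex ChbZ where
  X₁ := 𝟙_ ChbZ
  X₂ := C
  X₃ := T
  f := unitToC
  g := cToT
  zero := by
    ext : 1
    refine HomologicalComplex.from_single_hom_ext ?_
    exact (HomologicalComplex.isZero_single_obj_X _ _ _ _ (by simp)).eq_of_tgt _ _

/-- Degree-wise split short complexes: the conflations of the exact structure on `ChbZ`. -/
def degreewiseSplit : ObjectProperty (ShortComplex ChbZ) := fun S =>
  ∀ n : ℤ, Nonempty (S.map (boundedFree.ι ⋙ HomologicalComplex.eval _ _ n)).Splitting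

theorem degreewiseSplit_unitCT : degreewiseSplit unitCT := by
  intro n
  have hU : n ≠ 0 → IsZero ((𝟙_ ChbZ).obj.X n) := fun h =>
    HomologicalComplex.isZero_single_obj_X (.up ℤ) 0 (ModuleCat.of ℤ ℤ) n h
  have hT : n ≠ -1 → IsZero (T.obj.X n) := fun h =>
    HomologicalComplex.isZero_single_obj_X (.up ℤ) (-1) (ModuleCat.of ℤ ℤ) n h
  by_cases h0 : n = 0
  · subst h0
    exact ⟨@ShortComplex.Splitting.ofIsIsoOfIsZero _ _ _ _ isIso_singleToComplexC_f (hT (by simp))⟩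
  · refine ⟨@ShortComplex.Splitting.ofIsZeroOfIsIso _ _ _ _ (hU h0) ?_⟩
    by_cases h1 : n = -1
    · subst h1
      exact isIso_complexCToSingle_f
    · exact ⟨0, (isZero_complexC_X n h1 h0).eq_of_src _ _,
        (hT h1).eq_of_src _ _⟩

/-- Homotopy equivalences of `ChbZ`: homotopy equivalences of cochain complexes. -/
def chHomotopyEquivalences : MorphismProperty ChbZ := fun a b f =>
  ∃ e : HomotopyEquiv a.obj b.obj, e.hom = f.hom

/-! ### Exact categories -/

section Exact

variable {E : Type*} [Category E] [Preadditive E]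

/-- The first maps of the short complexes in a given class. -/
def firstMaps (P : ObjectProperty (ShortComplex E)) : MorphismProperty E := fun _ y i =>
  ∃ (z : E) (p : y ⟶ z) (h : i ≫ p = 0), P (ShortComplex.mk i p h)

/-- The second maps of the short complexes in a given class. -/
def secondMaps (P : ObjectProperty (ShortComplex E)) : MorphismProperty E := fun y _ p =>
  ∃ (x : E) (i : x ⟶ y) (h : i ≫ p = 0), P (ShortComplex.mk i p h)

variable (E) in
/-- A Quillen exact structure on an additive category. -/
class ExactCategory [HasZeroObject E] [HasBinaryBiproducts E] where
  conflation : ObjectProperty (ShortComplex E)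
  conflation_of_iso {S S' : ShortComplex E} (e : S ≅ S') : conflation S → conflation S'
  isKernel {S : ShortComplex E} : conflation S → Nonempty (IsLimit (KernelFork.ofι S.f S.zero))
  isCokernel {S : ShortComplex E} :
    conflation S → Nonempty (IsColimit (CokernelCofork.ofπ S.g S.zero))
  id_inflation (x : E) : firstMaps conflation (𝟙 x)
  id_deflation (x : E) : secondMaps conflation (𝟙 x)
  comp_inflation {x y z : E} (i : x ⟶ y) (j : y ⟶ z) :
    firstMaps conflation i → firstMaps conflation j → firstMaps conflation (i ≫ j)
  comp_deflation {x y z : E} (p : x ⟶ y) (q : y ⟶ z) :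
    secondMaps conflation p → secondMaps conflation q → secondMaps conflation (p ≫ q)
  pushout_inflation {x y x' : E} (i : x ⟶ y) (f : x ⟶ x') : firstMaps conflation i →
    ∃ (y' : E) (f' : y ⟶ y') (i' : x' ⟶ y'), IsPushout f i i' f' ∧ firstMaps conflation i'
  pullback_deflation {y z z' : E} (p : y ⟶ z) (f : z' ⟶ z) : secondMaps conflation p →
    ∃ (y' : E) (f' : y' ⟶ y) (p' : y' ⟶ z'), IsPullback f' p' p f ∧ secondMaps conflation p'

end Exact

/-! ### Complicial exact categories -/

open MonoidalLeftAction

/-- A complicial exact category: an exact category with a bi-exact action of `ChbZ`.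
Exact functors are additive functors that send conflations to conflations. -/
class ComplicialExactCategory (E : Type*) [Category E] [Preadditive E] [HasZeroObject E]
    [HasBinaryBiproducts E] [ExactCategory E] extends MonoidalLeftAction ChbZ E where
  [additive_actionLeft (a : ChbZ) : (actionLeft E a).Additive]
  [additive_actionRight (x : E) : (actionRight ChbZ x).Additive]
  conflation_actionLeft (a : ChbZ) (S : ShortComplex E) : ExactCategory.conflation S →
    ExactCategory.conflation (S.map (actionLeft E a))
  conflation_actionRight (x : E) (S : ShortComplex ChbZ) : degreewiseSplit S →
    ExactCategory.conflation (S.map (actionRight ChbZ x))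

attribute [instance] ComplicialExactCategory.additive_actionLeft
  ComplicialExactCategory.additive_actionRight

section

variable {E : Type*} [Category E] [Preadditive E] [HasZeroObject E] [HasBinaryBiproducts E]
  [ExactCategory E]

/-- Inflations: the first maps of conflations. -/
def IsInflation {x y : E} (i : x ⟶ y) : Prop := firstMaps ExactCategory.conflation i

/-- Deflations: the second maps of conflations. -/
def IsDeflation {x y : E} (p : x ⟶ y) : Prop := secondMaps ExactCategory.conflation p

variable [ComplicialExactCategory E]

/-- The inflation `x ⟶ C ⊗ x`. -/
def toC (x : E) : x ⟶ C ⊙ₗ x := (λₗ[ChbZ] x).inv ≫ unitToC ⊵ₗ x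

theorem isInflation_toC (x : E) : IsInflation (toC x) := by
  have h : unitToC ⊵ₗ x ≫ cToT ⊵ₗ x = 0 := (unitCT.map (actionRight ChbZ x)).zero
  have h' : toC x ≫ cToT ⊵ₗ x = 0 := by rw [toC, Category.assoc, h, comp_zero]
  refine ⟨T ⊙ₗ x, cToT ⊵ₗ x, h', ?_⟩
  refine ExactCategory.conflation_of_iso (S := unitCT.map (actionRight ChbZ x)) ?_
    (ComplicialExactCategory.conflation_actionRight x unitCT degreewiseSplit_unitCT)
  refine ShortComplex.isoMk (λₗ[ChbZ] x) (Iso.refl (C ⊙ₗ x)) (Iso.refl (T ⊙ₗ x)) ?_ ?_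
  · change (λₗ[ChbZ] x).hom ≫ (λₗ[ChbZ] x).inv ≫ unitToC ⊵ₗ x = unitToC ⊵ₗ x ≫ 𝟙 _
    simp
  · change 𝟙 _ ≫ cToT ⊵ₗ x = cToT ⊵ₗ x ≫ 𝟙 _
    simp

instance hasPushout_toC {x y : E} (f : x ⟶ y) : HasPushout f (toC x) := by
  obtain ⟨_, _, _, h, _⟩ := ExactCategory.pushout_inflation (toC x) f (isInflation_toC x)
  exact h.hasPushout

/-- The cone of `f : x ⟶ y`: the pushout of `f` along `x ⟶ C ⊗ x`. -/
def cone {x y : E} (f : x ⟶ y) : E := pushout f (toC x)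

/-- Inflations along which all maps to objects `C ⊗ u` extend. -/
def IsFrobeniusInflation {x y : E} (i : x ⟶ y) : Prop :=
  IsInflation i ∧ ∀ (u : E) (f : x ⟶ C ⊙ₗ u), ∃ g : y ⟶ C ⊙ₗ u, i ≫ g = f

/-- Deflations along which all maps from objects `C ⊗ u` lift. -/
def IsFrobeniusDeflation {x y : E} (p : x ⟶ y) : Prop :=
  IsDeflation p ∧ ∀ (u : E) (f : C ⊙ₗ u ⟶ y), ∃ g : C ⊙ₗ u ⟶ x, g ≫ p = f

/-- The projective-injective objects for the Frobenius exact structure. -/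
def IsProjectiveInjective (q : E) : Prop :=
  (∀ {x y : E} (p : x ⟶ y), IsFrobeniusDeflation p → ∀ f : q ⟶ y, ∃ g : q ⟶ x, g ≫ p = f) ∧
  (∀ {x y : E} (i : x ⟶ y), IsFrobeniusInflation i → ∀ f : x ⟶ q, ∃ g : y ⟶ q, i ≫ g = f)

/-- Two maps are homotopic if their difference factors through a projective-injective object. -/
def Homotopic {x y : E} (f g : x ⟶ y) : Prop :=
  ∃ q : E, IsProjectiveInjective q ∧ ∃ (a : x ⟶ q) (b : q ⟶ y), f - g = a ≫ b

/-- The maps that are invertible up to homotopy. -/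
def homotopyEquivalences (E : Type*) [Category E] [Preadditive E] [HasZeroObject E]
    [HasBinaryBiproducts E] [ExactCategory E] [ComplicialExactCategory E] :
    MorphismProperty E := fun x y f =>
  ∃ g : y ⟶ x, Homotopic (f ≫ g) (𝟙 x) ∧ Homotopic (g ≫ f) (𝟙 y)

/-- Classes of weak equivalences: compatible with the action, containing the homotopy equivalences,
with the two-out-of-three property, closed under extensions and under retracts (in the arrow
category). -/
structure IsClassOfWeakEquivalences (w : MorphismProperty E) : Prop where
  tensor {a b : ChbZ} {x y : E} (f : a ⟶ b) (g : x ⟶ y) :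
    chHomotopyEquivalences f → w g → w (f ⊙ₗₘ g)
  homotopyEquivalences_le : homotopyEquivalences E ≤ w
  twoOutOfThree : w.HasTwoOutOfThreeProperty
  extension {S S' : ShortComplex E} (φ : S ⟶ S') : ExactCategory.conflation S →
    ExactCategory.conflation S' → w φ.τ₁ → w φ.τ₃ → w φ.τ₂
  retract : w.IsStableUnderRetracts

/-- Null classes: additive full subcategories that are closed under homotopy equivalences, the
action of `ChbZ`, extensions and retracts. -/
structure IsNullClass (N : ObjectProperty E) : Prop where
  zero : N 0
  biprod {x y : E} : N x → N y → N (x ⊞ y)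
  homotopyEquivalent {x y : E} (f : x ⟶ y) : homotopyEquivalences E f → N x → N y
  tensor (a : ChbZ) {x : E} : N x → N (a ⊙ₗ x)
  extension {S : ShortComplex E} : ExactCategory.conflation S → N S.X₁ → N S.X₃ → N S.X₂
  retract {x y : E} (i : x ⟶ y) (p : y ⟶ x) : i ≫ p = 𝟙 x → N y → N x

/-- The `w`-trivial objects: those `x` with `0 ⟶ x` in `w`. -/
def trivialObjects (w : MorphismProperty E) : ObjectProperty E := fun x => w (0 : (0 : E) ⟶ x)

/-- The maps with cone in `N`. -/
def coneIn (N : ObjectProperty E) : MorphismProperty E := fun _ _ f => N (cone f)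

end

end Complicial

end

noncomputable section

namespace Complicial

/-! For `f : x ⟶ y` the conflation x → y ⊕ Cx → Cone(f) replaces `f`, up to the homotopy equivalence
y ⊕ Cx → y, by an inflation with cokernel Cone(f). If Cone(f) is `w`-trivial, closure of `w` under
extensions therefore puts `f` in `w`. Conversely, if `f` is in `w`, comparing x → Cx → Tx with y →
Cone(f) → Tx shows that Cx → Cone(f) is in `w`, and Cx is contractible. This is
`coneIn_trivialObjects`; the other composite, `trivialObjects_coneIn`, comes from the conflation x →
Cone(0 → x) → T ⊗ 0. The null class axioms for the trivial objects follow quickly from the axioms on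
`w`.

The main work is that maps with cone in a null class form a class of weak equivalences.
Two-out-of-three combines an octahedron (`exists_octahedron`) with two cancellation properties of
null classes (`third`, `first`). Closure under extensions holds because a morphism of conflations
induces a conflation of cones (`IsConflation.coneMap`). Homotopy equivalences belong to the class
because their cones are contractible (`isNull_id_cone`).

Two facts about complexes of abelian groups support this. A null homotopic map K → L extends along K
→ C ⊗ K (`contract`), so x → Cx is a Frobenius inflation into a projective-injective object, and
chain homotopies act as homotopies in `E`. Also, the unit is a retract of `TInv ⊗ T`
(`exists_retract_shifts`), so the shift `T` can be undone inside a null class. -/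

/-- Cochain complexes of abelian groups. -/
abbrev ComplexZ := CochainComplex (ModuleCat.{0} ℤ) ℤ

/-! ### Tensor products of complexes and null homotopies -/

open HomologicalComplex in
theorem ι_tensor_d (K L : ComplexZ) (i j n m : ℤ) (h : i + j = n) (hm : n + 1 = m) :
    ιTensorObj K L i j n h ≫ (K ⊗ L).d n m =
      K.d i (i + 1) ▷ L.X j ≫ ιTensorObj K L (i + 1) j m (by omega) +
        i.negOnePow • (K.X i ◁ L.d j (j + 1) ≫ ιTensorObj K L i (j + 1) m (by omega)) := by
  change ιTensorObj K L i j n h ≫ (mapBifunctor K L (curriedTensor _) (.up ℤ)).d n m = _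
  rw [mapBifunctor.d_eq, Preadditive.comp_add, mapBifunctor.ι_D₁, mapBifunctor.ι_D₂,
    mapBifunctor.d₁_eq K L (curriedTensor _) (.up ℤ) (i₁ := i) (i₁' := i + 1) (by simp) j m
      (by change i + 1 + j = m; omega),
    mapBifunctor.d₂_eq K L (curriedTensor _) (.up ℤ) i (i₂ := j) (i₂' := j + 1) (by simp) m
      (by change i + (j + 1) = m; omega)]
  congr 1
  exact one_smul _ _

open HomologicalComplex in
theorem ι_whiskerRight {K K' : ComplexZ} (f : K ⟶ K') (L : ComplexZ) (i j n : ℤ) (h : i + j = n) :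
    ιTensorObj K L i j n h ≫ (f ▷ L).f n = f.f i ▷ L.X j ≫ ιTensorObj K' L i j n h := by
  refine (ι_mapBifunctorMap f (𝟙 L) (curriedTensor _) (.up ℤ) i j n h).trans ?_
  simp

open HomologicalComplex in
theorem leftUnitor_inv_f (K : ComplexZ) (n : ℤ) :
    (λ_ K).inv.f n = (λ_ (K.X n)).inv ≫
      (singleObjXSelf (.up ℤ) 0 (𝟙_ (ModuleCat.{0} ℤ))).inv ▷ K.X n ≫
      ιTensorObj (𝟙_ ComplexZ) K 0 n n (zero_add n) :=
  leftUnitor'_inv K n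

theorem int_leftUnitor_naturality {M N : ModuleCat.{0} ℤ} (f : M ⟶ N) :
    ModuleCat.of ℤ ℤ ◁ f ≫ (λ_ N).hom = (λ_ M).hom ≫ f :=
  leftUnitor_naturality f

/-- The components of the map from `C ⊗ K` given by a null homotopy. -/
def contractComponent {K L : ComplexZ} (f : K ⟶ L) (H : Homotopy f 0) (n i j : ℤ)
    (h : i + j = n) : complexC.X i ⊗ K.X j ⟶ L.X n :=
  if h₀ : i = 0 then
    ((complexC.XIsoOfEq h₀).hom ≫ complexCXZero.hom) ▷ K.X j ≫ (λ_ (K.X j)).hom ≫ f.f j ≫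
      (L.XIsoOfEq (by omega)).hom
  else if h₁ : i = -1 then
    ((complexC.XIsoOfEq h₁).hom ≫ complexCXNegOne.hom) ▷ K.X j ≫ (λ_ (K.X j)).hom ≫ H.hom j n
  else 0

theorem contractComponent_zero {K L : ComplexZ} (f : K ⟶ L) (H : Homotopy f 0) (n : ℤ) :
    contractComponent f H n 0 n (zero_add n) =
      complexCXZero.hom ▷ K.X n ≫ (λ_ (K.X n)).hom ≫ f.f n := by
  simp [contractComponent]

theorem contractComponent_neg_one {K L : ComplexZ} (f : K ⟶ L) (H : Homotopy f 0) (n j : ℤ)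
    (h : -1 + j = n) :
    contractComponent f H n (-1) j h =
      complexCXNegOne.hom ▷ K.X j ≫ (λ_ (K.X j)).hom ≫ H.hom j n := by
  simp [contractComponent]

theorem complexC_d : complexC.d (-1) 0 = complexCXNegOne.hom ≫ complexCXZero.inv := by
  refine (HomologicalComplex.double_d (𝟙 (ModuleCat.of ℤ ℤ)) up_rel (by simp)).trans ?_
  rw [Category.id_comp]; rfl

open HomologicalComplex in
/-- The map from `C ⊗ K` given by a null homotopy. -/
def contract {K L : ComplexZ} (f : K ⟶ L) (H : Homotopy f 0) : complexC ⊗ K ⟶ L where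
  f n := mapBifunctorDesc (F := curriedTensor _) (fun i j h => contractComponent f H n i j h)
  comm' n m hm := by
    replace hm : n + 1 = m := hm
    refine mapBifunctor.hom_ext (F := curriedTensor _) ?_
    intro i j (h : i + j = n)
    rw [ι_mapBifunctorDesc_assoc]
    refine Eq.trans ?_ (Category.assoc _ _ _)
    refine Eq.trans ?_ (congrArg (· ≫ mapBifunctorDesc (F := curriedTensor _) _)
      (ι_tensor_d complexC K i j n m h hm).symm)
    simp only [Preadditive.add_comp, Linear.units_smul_comp, Category.assoc]
    erw [ι_mapBifunctorDesc, ι_mapBifunctorDesc]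
    -- Only degrees 0 and -1 of `C` matter. In degree 0 the identity says that `f` is a chain map.
    -- In degree -1 it is the homotopy relation for `H`, the Koszul sign moving one of its two terms
    -- across.
    by_cases h₀ : i = 0
    · subst h₀
      obtain rfl : j = n := by omega
      obtain rfl : m = j + 1 := by omega
      rw [contractComponent_zero, contractComponent_zero, complexC_d_zero]
      simp [whisker_exchange_assoc, reassoc_of% @int_leftUnitor_naturality]
    by_cases h₁ : i = -1
    · subst h₁
      obtain rfl : j = m := by omega
      rw [contractComponent_neg_one, contractComponent_neg_one]
      change _ = complexC.d (-1) 0 ▷ K.X j ≫ contractComponent f H j 0 j _ + _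
      rw [contractComponent_zero, complexC_d]
      have := H.comm j
      rw [dNext_eq H.hom (show (ComplexShape.up ℤ).Rel j (j + 1) from rfl),
        prevD_eq H.hom (show (ComplexShape.up ℤ).Rel n j from hm)] at this
      simp only [this]
      simp [whisker_exchange_assoc, reassoc_of% @int_leftUnitor_naturality, -comp_whiskerRight,
        ← comp_whiskerRight_assoc]
    · exact (isZero_tensor (Or.inl (isZero_complexC_X i h₁ h₀))).eq_of_src _ _

open HomologicalComplex in
theorem contract_fac {K L : ComplexZ} (f : K ⟶ L) (H : Homotopy f 0) :
    (λ_ K).inv ≫ singleToComplexC ▷ K ≫ contract f H = f := by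
  ext1 n
  rw [comp_f, comp_f, leftUnitor_inv_f, Category.assoc, Category.assoc]
  have h1 := ι_whiskerRight singleToComplexC K 0 n n (zero_add n)
  have h2 : ιTensorObj complexC K 0 n n (zero_add n) ≫ (contract f H).f n = _ :=
    ι_mapBifunctorDesc (F := curriedTensor _) (fun i j h => contractComponent f H n i j h) 0 n
      (zero_add n)
  erw [reassoc_of% h1, h2]
  rw [contractComponent_zero, singleToComplexC, mkHomFromSingle_f]
  have h3 : (singleObjXSelf (.up ℤ) 0 (𝟙_ (ModuleCat.{0} ℤ))).inv ▷ K.X n ≫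
      ((singleObjXSelf (.up ℤ) 0 (ModuleCat.of ℤ ℤ)).hom ≫ complexCXZero.inv) ▷ K.X n ≫
        complexCXZero.hom ▷ K.X n = 𝟙 _ := by
    rw [← comp_whiskerRight, ← comp_whiskerRight, Category.assoc, complexCXZero.inv_hom_id,
      Category.comp_id]
    exact (congrArg (· ▷ K.X n) (Iso.inv_hom_id _)).trans (id_whiskerRight _ _)
  erw [reassoc_of% h3, Iso.inv_hom_id_assoc]

/-- The identity of `C` is null homotopic. -/
def complexCHomotopy : Homotopy (𝟙 complexC) 0 where
  hom i j := if h : i = 0 ∧ j = -1 then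
    (complexC.XIsoOfEq h.1).hom ≫ complexCXZero.hom ≫ complexCXNegOne.inv ≫
      (complexC.XIsoOfEq h.2.symm).hom else 0
  zero i j hij := dif_neg (by rintro ⟨rfl, rfl⟩; simp at hij)
  comm n := by
    rw [dNext_eq _ (show (ComplexShape.up ℤ).Rel n (n + 1) from rfl),
      prevD_eq _ (show (ComplexShape.up ℤ).Rel (n - 1) n by simp)]
    by_cases h₀ : n = 0
    · subst h₀
      have h : complexC.d (0 - 1) 0 = complexC.d (-1) 0 := rfl
      rw [h, complexC_d]
      simp
    by_cases h₁ : n = -1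
    · subst h₁
      have h : complexC.d (-1) (-1 + 1) = complexC.d (-1) 0 := rfl
      rw [h, complexC_d]
      simp
    · exact (isZero_complexC_X n h₁ h₀).eq_of_src _ _

theorem exists_contract {a b : ChbZ} (f : a ⟶ b) (H : Homotopy f.hom 0) :
    ∃ g : C ⊗ a ⟶ b, (λ_ a).inv ≫ unitToC ▷ a ≫ g = f :=
  ⟨ObjectProperty.homMk (contract f.hom H), by
    ext1; exact contract_fac f.hom H⟩

theorem exists_contract_complexC :
    ∃ g : C ⊗ C ⟶ C, (λ_ C).inv ≫ unitToC ▷ C ≫ g = 𝟙 C :=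
  exists_contract (𝟙 C) complexCHomotopy

/-! ### Undoing the shift -/

/-- The complex with `ℤ` in degree `n` and zero elsewhere. -/
abbrev singleZ (n : ℤ) : ComplexZ :=
  (HomologicalComplex.single (ModuleCat.{0} ℤ) (.up ℤ) n).obj (ModuleCat.of ℤ ℤ)

/-- The degree `n` part of `singleZ n`. -/
def singleZX (n : ℤ) : (singleZ n).X n ≅ ModuleCat.of ℤ ℤ :=
  HomologicalComplex.singleObjXSelf (.up ℤ) n (ModuleCat.of ℤ ℤ)

theorem isZero_singleZ_X (n i : ℤ) (h : i ≠ n) : IsZero ((singleZ n).X i) :=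
  HomologicalComplex.isZero_single_obj_X _ _ _ _ h

/-- `ℤ` in degree `1`. -/
def TInv : ChbZ := ⟨singleZ 1, boundedFree_single 1⟩

theorem isZero_singleZ_tensor_X (n : ℤ) (hn : n ≠ 0) :
    IsZero ((singleZ 1 ⊗ singleZ (-1)).X n) := by
  rw [IsZero.iff_id_eq_zero]
  refine HomologicalComplex.mapBifunctor.hom_ext (F := curriedTensor _) ?_
  intro i j (h : i + j = n)
  refine (isZero_tensor ?_).eq_of_src _ _
  by_cases h1 : i = 1
  · exact Or.inr (isZero_singleZ_X _ _ (by omega))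
  · exact Or.inl (isZero_singleZ_X _ _ h1)

/-- The inclusion of the unit into the product of the two shifts. -/
def unitToShifts : singleZ 0 ⟶ singleZ 1 ⊗ singleZ (-1) :=
  HomologicalComplex.mkHomFromSingle
    ((λ_ (ModuleCat.of ℤ ℤ)).inv ≫ ((singleZX 1).inv ⊗ₘ (singleZX (-1)).inv) ≫
      HomologicalComplex.ιTensorObj (singleZ 1) (singleZ (-1)) 1 (-1) 0 (by simp))
    (fun k hk => (isZero_singleZ_tensor_X k (by rintro rfl; simp at hk)).eq_of_tgt _ _)

open Classical in
/-- The projection of the product of the two shifts onto the unit. -/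
def shiftsToUnit : singleZ 1 ⊗ singleZ (-1) ⟶ singleZ 0 :=
  HomologicalComplex.mkHomToSingle
    (HomologicalComplex.mapBifunctorDesc (F := curriedTensor _) (fun i j (h : i + j = 0) =>
      if hi : i = 1 then
        ((((singleZ 1).XIsoOfEq hi).hom ≫ (singleZX 1).hom) ⊗ₘ
          (((singleZ (-1)).XIsoOfEq (by omega)).hom ≫ (singleZX (-1)).hom)) ≫
          (λ_ (ModuleCat.of ℤ ℤ)).hom
      else 0))
    (fun k hk => (isZero_singleZ_tensor_X k (by rintro rfl; simp at hk)).eq_of_src _ _)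

theorem unitToShifts_shiftsToUnit : unitToShifts ≫ shiftsToUnit = 𝟙 _ := by
  refine HomologicalComplex.from_single_hom_ext ?_
  rw [HomologicalComplex.comp_f, unitToShifts, shiftsToUnit,
    HomologicalComplex.mkHomFromSingle_f, HomologicalComplex.mkHomToSingle_f]
  simp only [Category.assoc]
  erw [HomologicalComplex.ι_mapBifunctorDesc_assoc]
  simp

/-- Both factors live in a single degree, so their product lives in degree 0, where the maps are the
canonical identifications with ℤ. One composite suffices, since null classes are closed under
retracts. -/
theorem exists_retract_shifts :
    ∃ (i : 𝟙_ ChbZ ⟶ TInv ⊗ T) (p : TInv ⊗ T ⟶ 𝟙_ ChbZ), i ≫ p = 𝟙 _ :=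
  ⟨ObjectProperty.homMk unitToShifts, ObjectProperty.homMk shiftsToUnit, by
    ext1; exact unitToShifts_shiftsToUnit⟩

open MonoidalLeftAction

/-! ### Conflations in an exact category -/

section

variable {E : Type*} [Category E] [Preadditive E] [HasZeroObject E] [HasBinaryBiproducts E]
  [ExactCategory E]

/-- The pair `x ⟶ y ⟶ z` is a conflation. -/
def IsConflation {x y z : E} (i : x ⟶ y) (p : y ⟶ z) : Prop :=
  ∃ h : i ≫ p = 0, ExactCategory.conflation (ShortComplex.mk i p h)

namespace IsConflation

variable {x y z : E} {i : x ⟶ y} {p : y ⟶ z}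

theorem of_shortComplex {S : ShortComplex E} (h : ExactCategory.conflation S) :
    IsConflation S.f S.g := ⟨S.zero, h⟩

theorem isInflation (h : IsConflation i p) : IsInflation i := ⟨z, p, h.1, h.2⟩

theorem isDeflation (h : IsConflation i p) : IsDeflation p := ⟨x, i, h.1, h.2⟩

theorem zero (h : IsConflation i p) : i ≫ p = 0 := h.1

theorem mono (h : IsConflation i p) : Mono i := by
  obtain ⟨w, h⟩ := h
  obtain ⟨l⟩ := ExactCategory.isKernel h
  exact mono_of_isLimit_fork l

theorem epi (h : IsConflation i p) : Epi p := by
  obtain ⟨w, h⟩ := h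
  obtain ⟨l⟩ := ExactCategory.isCokernel h
  exact epi_of_isColimit_cofork l

theorem exists_lift (h : IsConflation i p) {t : E} (f : t ⟶ y) (hf : f ≫ p = 0) :
    ∃ g : t ⟶ x, g ≫ i = f := by
  obtain ⟨w, h⟩ := h
  obtain ⟨l⟩ := ExactCategory.isKernel h
  exact ⟨l.lift (KernelFork.ofι f hf), l.fac _ WalkingParallelPair.zero⟩

theorem exists_desc (h : IsConflation i p) {t : E} (f : y ⟶ t) (hf : i ≫ f = 0) :
    ∃ g : z ⟶ t, p ≫ g = f := by
  obtain ⟨w, h⟩ := h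
  obtain ⟨l⟩ := ExactCategory.isCokernel h
  exact ⟨l.desc (CokernelCofork.ofπ f hf), l.fac _ WalkingParallelPair.one⟩

theorem of_iso (h : IsConflation i p) {x' y' z' : E} {i' : x' ⟶ y'} {p' : y' ⟶ z'}
    (e₁ : x ≅ x') (e₂ : y ≅ y') (e₃ : z ≅ z') (comm₁ : e₁.hom ≫ i' = i ≫ e₂.hom)
    (comm₂ : e₂.hom ≫ p' = p ≫ e₃.hom) : IsConflation i' p' := by
  have w : i' ≫ p' = 0 := by
    rw [← cancel_epi e₁.hom, reassoc_of% comm₁, comm₂, reassoc_of% h.zero, zero_comp, comp_zero]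
  exact ⟨w, ExactCategory.conflation_of_iso (ShortComplex.isoMk e₁ e₂ e₃ comm₁ comm₂) h.2⟩

/-- Any two cokernels of an inflation are isomorphic, and conflations are invariant under
isomorphism; so a cokernel property is all that has to be checked. -/
theorem of_isInflation (hi : IsInflation i) (w : i ≫ p = 0) [Epi p]
    (desc : ∀ {t : E} (f : y ⟶ t), i ≫ f = 0 → ∃ g : z ⟶ t, p ≫ g = f) : IsConflation i p := by
  obtain ⟨z₀, p₀, w₀, h⟩ := hi
  have h : IsConflation i p₀ := ⟨w₀, h⟩
  have := h.epi
  obtain ⟨u, hu⟩ := desc p₀ w₀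
  obtain ⟨v, hv⟩ := h.exists_desc p w
  exact h.of_iso (Iso.refl _) (Iso.refl _)
    ⟨v, u, by rw [← cancel_epi p₀, reassoc_of% hv, hu, Category.comp_id],
      by rw [← cancel_epi p, reassoc_of% hu, hv, Category.comp_id]⟩ (by simp) (by simp [hv])

theorem of_isDeflation (hp : IsDeflation p) (w : i ≫ p = 0) [Mono i]
    (lift : ∀ {t : E} (f : t ⟶ y), f ≫ p = 0 → ∃ g : t ⟶ x, g ≫ i = f) : IsConflation i p := by
  obtain ⟨x₀, i₀, w₀, h⟩ := hp
  have h : IsConflation i₀ p := ⟨w₀, h⟩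
  have := h.mono
  obtain ⟨u, hu⟩ := lift i₀ w₀
  obtain ⟨v, hv⟩ := h.exists_lift i w
  exact h.of_iso ⟨u, v, by rw [← cancel_mono i₀, Category.assoc, hv, hu, Category.id_comp],
      by rw [← cancel_mono i, Category.assoc, hu, hv, Category.id_comp]⟩
      (Iso.refl _) (Iso.refl _) (by simp [hu]) (by simp)

theorem zero_id (z x : E) (hz : IsZero z) : IsConflation (0 : z ⟶ x) (𝟙 x) := by
  obtain ⟨w, i, h, hc⟩ := ExactCategory.id_deflation x
  have hc : IsConflation i (𝟙 x) := ⟨h, hc⟩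
  have := hc.mono
  have hi : i = 0 := by simpa using h
  have hw : IsZero w := by
    rw [IsZero.iff_id_eq_zero, ← cancel_mono i, hi, comp_zero, comp_zero]
  exact hc.of_iso (hw.iso hz) (Iso.refl _) (Iso.refl _) (by simp [hi]) (by simp)

theorem id_zero (x z : E) (hz : IsZero z) : IsConflation (𝟙 x) (0 : x ⟶ z) := by
  obtain ⟨w, p, h, hc⟩ := ExactCategory.id_inflation x
  have hc : IsConflation (𝟙 x) p := ⟨h, hc⟩
  have := hc.epi
  have hi : p = 0 := by simpa using h
  have hw : IsZero w := by
    rw [IsZero.iff_id_eq_zero, ← cancel_epi p, hi, zero_comp, zero_comp]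
  exact hc.of_iso (Iso.refl _) (Iso.refl _) (hw.iso hz) (by simp) (by simp [hi])

/-- The cokernel of an inflation is preserved by pushouts. -/
theorem pushout (h : IsConflation i p) {x' y' : E} {f : x ⟶ x'} {i' : x' ⟶ y'} {f' : y ⟶ y'}
    (sq : IsPushout f i i' f') : ∃ p' : y' ⟶ z, IsConflation i' p' ∧ f' ≫ p' = p := by
  have hi' : IsInflation i' := by
    obtain ⟨y₀, f₀, i₀, sq₀, z₀, p₀, w₀, h₀⟩ := ExactCategory.pushout_inflation i f h.isInflation
    have h₀ : IsConflation i₀ p₀ := ⟨w₀, h₀⟩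
    exact (h₀.of_iso (i' := i') (p' := (sq.isoIsPushout _ _ sq₀).hom ≫ p₀) (Iso.refl _)
      (sq₀.isoIsPushout _ _ sq) (Iso.refl _) (by simp)
      (by rw [← Category.assoc]; erw [Category.comp_id]
          refine sq₀.hom_ext ?_ ?_ <;> simp)).isInflation
  have hw : f ≫ 0 = i ≫ p := by rw [comp_zero, h.zero]
  have := h.epi
  refine ⟨sq.desc 0 p hw, ?_, sq.inr_desc _ _ _⟩
  have : Epi (sq.desc 0 p hw) := ⟨fun a b hab => by
    rw [← cancel_epi p, ← sq.inr_desc 0 p hw, Category.assoc, Category.assoc, hab]⟩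
  refine of_isInflation hi' (sq.inl_desc _ _ _) (fun t ht => ?_)
  obtain ⟨g, hg⟩ := h.exists_desc (f' ≫ t) (by rw [← reassoc_of% sq.w, ht, comp_zero])
  refine ⟨g, sq.hom_ext ?_ ?_⟩
  · rw [sq.inl_desc_assoc, zero_comp, ht]
  · rw [sq.inr_desc_assoc, hg]

/-- The kernel of a deflation is preserved by pullbacks. -/
theorem pullback (h : IsConflation i p) {y' z' : E} {f : z' ⟶ z} {p' : y' ⟶ z'} {f' : y' ⟶ y}
    (sq : IsPullback f' p' p f) : ∃ i' : x ⟶ y', IsConflation i' p' ∧ i' ≫ f' = i := by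
  have hp' : IsDeflation p' := by
    obtain ⟨y₀, f₀, p₀, sq₀, x₀, i₀, w₀, h₀⟩ := ExactCategory.pullback_deflation p f h.isDeflation
    have h₀ : IsConflation i₀ p₀ := ⟨w₀, h₀⟩
    exact (h₀.of_iso (i' := i₀ ≫ (sq₀.isoIsPullback _ _ sq).hom) (p' := p') (Iso.refl _)
      (sq₀.isoIsPullback _ _ sq) (Iso.refl _) (by simp) (by simp)).isDeflation
  have hw : i ≫ p = 0 ≫ f := by rw [zero_comp, h.zero]
  have := h.mono
  refine ⟨sq.lift i 0 hw, ?_, sq.lift_fst _ _ _⟩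
  have : Mono (sq.lift i 0 hw) := ⟨fun a b hab => by
    rw [← cancel_mono i, ← sq.lift_fst i 0 hw, reassoc_of% hab]⟩
  refine of_isDeflation hp' (sq.lift_snd _ _ _) (fun t ht => ?_)
  obtain ⟨g, hg⟩ := h.exists_lift (t ≫ f') (by rw [Category.assoc, sq.w, reassoc_of% ht, zero_comp])
  refine ⟨g, sq.hom_ext ?_ ?_⟩
  · rw [Category.assoc, sq.lift_fst, hg]
  · rw [Category.assoc, sq.lift_snd, comp_zero, ht]

theorem inl_snd (x z : E) : IsConflation (biprod.inl : x ⟶ x ⊞ z) biprod.snd := by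
  obtain ⟨p', h, hp'⟩ := (zero_id 0 z (isZero_zero E)).pushout
    (IsPushout.of_has_biproduct x z)
  obtain rfl : p' = biprod.snd := biprod.hom_ext' _ _ (by simpa using h.zero) (by simpa using hp')
  exact h

theorem of_splitting {x y z : E} {i : x ⟶ y} {p : y ⟶ z} (r : y ⟶ x) (s : z ⟶ y)
    (hir : i ≫ r = 𝟙 x) (hsp : s ≫ p = 𝟙 z) (hip : i ≫ p = 0)
    (h : r ≫ i + p ≫ s = 𝟙 y) : IsConflation i p := by
  have hsr : s ≫ r = 0 := by
    have := s ≫= h =≫ r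
    simpa [hir, reassoc_of% hsp] using this
  refine (inl_snd x z).of_iso (Iso.refl _) ⟨biprod.desc i s, biprod.lift r p, ?_, ?_⟩
    (Iso.refl _) ?_ ?_
  · ext <;> simp [hir, hip, hsp, hsr]
  · simpa using h
  · simp
  · ext <;> simp [hip, hsp]

/-- The map (f, i) is the split inflation (f, 1) : x → w ⊕ x followed by 1 ⊕ i, which is a pushout
of `i`. Its cokernel is the pushout by the universal property. -/
theorem lift_desc {x w y P : E} {f : x ⟶ w} {i : x ⟶ y} {a : w ⟶ P} {b : y ⟶ P}
    (hi : IsInflation i) (sq : IsPushout f i a b) :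
    IsConflation (biprod.lift f i) (biprod.desc a (-b)) := by
  obtain ⟨z, p, hw, hi⟩ := hi
  have hi : IsConflation i p := ⟨hw, hi⟩
  have h₁ : IsConflation (biprod.lift f (𝟙 x)) (biprod.desc (𝟙 w) (-f)) :=
    of_splitting biprod.snd biprod.inl (by simp) (by simp) (by simp) (by ext <;> simp)
  have sq₁ : IsPushout (biprod.inr : x ⟶ w ⊞ x) i (biprod.map (𝟙 w) i) biprod.inr :=
    ⟨⟨by simp⟩, ⟨PushoutCocone.IsColimit.mk _
      (fun s => biprod.desc (biprod.inl ≫ s.inl) s.inr)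
      (fun s => by ext <;> simp [s.condition]) (fun s => by simp)
      (fun s m h₁ h₂ => by ext <;> simp [← h₁, ← h₂])⟩⟩
  obtain ⟨p', h₂, -⟩ := hi.pushout sq₁
  have h₃ : IsInflation (biprod.lift f i) := by
    have := ExactCategory.comp_inflation _ _ h₁.isInflation h₂.isInflation
    have hl : biprod.lift f (𝟙 x) ≫ biprod.map (𝟙 w) i = biprod.lift f i := by ext <;> simp
    rwa [hl] at this
  have : Epi (biprod.desc a (-b)) := ⟨fun u v huv => by
    have hl := biprod.inl ≫= huv
    have hr := biprod.inr ≫= huv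
    refine sq.hom_ext ?_ ?_
    · simpa using hl
    · simpa using hr⟩
  refine of_isInflation h₃ (by simp [sq.w]) (fun t ht => ?_)
  rw [← Category.id_comp t, ← biprod.total, Preadditive.add_comp, Preadditive.comp_add] at ht
  simp only [Category.assoc, biprod.lift_fst_assoc, biprod.lift_snd_assoc] at ht
  refine ⟨sq.desc (biprod.inl ≫ t) (-(biprod.inr ≫ t)) ?_, ?_⟩
  · rw [Preadditive.comp_neg]; exact eq_neg_of_add_eq_zero_left ht
  · ext <;> simp

/-- The short five lemma. -/
theorem isIso_of_comp {x y y' z : E} {i : x ⟶ y} {p : y ⟶ z} {i' : x ⟶ y'} {p' : y' ⟶ z}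
    (h : IsConflation i p) (h' : IsConflation i' p') (g : y ⟶ y') (hi : i ≫ g = i')
    (hp : g ≫ p' = p) : IsIso g := by
  have := h.mono
  have := h'.mono
  have : Mono g := by
    refine Preadditive.mono_of_cancel_zero _ (fun {t} u hu => ?_)
    obtain ⟨s, rfl⟩ := h.exists_lift u (by rw [← hp, reassoc_of% hu, zero_comp])
    have hs : s ≫ i' = 0 := by rw [← hi, ← Category.assoc, hu]
    rw [zero_of_comp_mono i' hs, zero_comp]
  -- To invert `g`, pass to the pullback of `p` and `p'`: there `f₂` lifts through `g` after
  -- correcting `f₁` by a map into `x`, and the lift descends along the deflation `f₂` because `g`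
  -- is mono.
  obtain ⟨P, f₁, f₂, sq, -⟩ := ExactCategory.pullback_deflation p p' h.isDeflation
  obtain ⟨m, hm, -⟩ := h.pullback sq
  have := hm.epi
  obtain ⟨s, hs⟩ := h'.exists_lift (f₁ ≫ g - f₂)
    (by rw [Preadditive.sub_comp, Category.assoc, hp, sq.w, sub_self])
  have key : (f₁ - s ≫ i) ≫ g = f₂ := by
    rw [Preadditive.sub_comp, Category.assoc, hi, hs, sub_sub_cancel]
  obtain ⟨r, hr⟩ := hm.exists_desc (f₁ - s ≫ i) (by
    rw [← cancel_mono g, Category.assoc, key, hm.zero, zero_comp])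
  have hrg : r ≫ g = 𝟙 _ := by
    rw [← cancel_epi f₂, reassoc_of% hr, key, Category.comp_id]
  exact ⟨r, by rw [← cancel_mono g, Category.assoc, hrg, Category.comp_id, Category.id_comp], hrg⟩

end IsConflation

end

section

variable {E : Type*} [Category E] [Preadditive E] [HasZeroObject E] [HasBinaryBiproducts E]
  [ExactCategory E] [ComplicialExactCategory E]

/-! ### The action and the inflations `x ⟶ C ⊗ x` -/

theorem actionHomLeft_sub {a b : ChbZ} (f g : a ⟶ b) (x : E) :
    (f - g) ⊵ₗ x = f ⊵ₗ x - g ⊵ₗ x :=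
  (actionRight ChbZ x).map_sub

theorem isZero_action (a : ChbZ) {x : E} (hx : IsZero x) : IsZero (a ⊙ₗ x : E) :=
  (actionLeft E a).map_isZero hx

theorem IsConflation.action (a : ChbZ) {x y z : E} {i : x ⟶ y} {p : y ⟶ z}
    (h : IsConflation i p) : IsConflation (a ⊴ₗ i) (a ⊴ₗ p) :=
  .of_shortComplex (ComplicialExactCategory.conflation_actionLeft a _ h.2)

theorem isConflation_toC (x : E) : IsConflation (toC x) (cToT ⊵ₗ x) :=
  (IsConflation.of_shortComplex (ComplicialExactCategory.conflation_actionRight x unitCT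
    degreewiseSplit_unitCT)).of_iso (λₗ[ChbZ] x) (Iso.refl (C ⊙ₗ x)) (Iso.refl (T ⊙ₗ x))
      (by change (λₗ[ChbZ] x).hom ≫ (λₗ[ChbZ] x).inv ≫ unitToC ⊵ₗ x = unitToC ⊵ₗ x ≫ 𝟙 _
          simp)
      (by change 𝟙 _ ≫ cToT ⊵ₗ x = cToT ⊵ₗ x ≫ 𝟙 _
          simp)

theorem toC_naturality {x y : E} (f : x ⟶ y) : toC x ≫ C ⊴ₗ f = f ≫ toC y := by
  simp only [toC, Category.assoc]
  rw [← action_exchange, actionUnitIso_inv_naturality_assoc]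

/-- Through this formula a factorization in `ChbZ` along a → C ⊗ a becomes one in `E` along a ⊗ x →
C(a ⊗ x). -/
theorem toC_action (a : ChbZ) (x : E) :
    toC (a ⊙ₗ x) = ((λ_ a).inv ≫ unitToC ▷ a) ⊵ₗ x ≫ (αₗ C a x).hom := by
  have h : (λ_ a).inv ⊵ₗ x = (λₗ[ChbZ] (a ⊙ₗ x)).inv ≫ (αₗ (𝟙_ ChbZ) a x).inv := by
    rw [← cancel_epi ((λ_ a).hom ⊵ₗ x), hom_inv_actionHomLeft, leftUnitor_actionHom]
    simp
  rw [toC, comp_actionHomLeft, h, whiskerRight_actionHomLeft]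
  simp only [Category.assoc, Iso.inv_hom_id, Iso.inv_hom_id_assoc, Category.comp_id]

theorem exists_retraction_toC (u : E) :
    ∃ g : C ⊙ₗ (C ⊙ₗ u) ⟶ (C ⊙ₗ u : E), toC (C ⊙ₗ u : E) ≫ g = 𝟙 _ := by
  obtain ⟨g, hg⟩ := exists_contract_complexC
  refine ⟨(αₗ C C u).inv ≫ g ⊵ₗ u, ?_⟩
  rw [toC_action, Category.assoc, Iso.hom_inv_id_assoc, ← comp_actionHomLeft, Category.assoc, hg,
    id_actionHomLeft]

/-! ### Frobenius inflations and projective-injective objects -/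

/-- A map `f` from `x` to `C ⊗ u` extends as `C ⊗ f` followed by a retraction of `C ⊗ u` → C(C ⊗ u),
by naturality of `toC`. -/
theorem isFrobeniusInflation_toC (x : E) : IsFrobeniusInflation (toC x) := by
  refine ⟨isInflation_toC x, fun u f => ?_⟩
  obtain ⟨g, hg⟩ := exists_retraction_toC u
  exact ⟨C ⊴ₗ f ≫ g, by rw [← Category.assoc, toC_naturality, Category.assoc, hg, Category.comp_id]⟩

theorem isProjectiveInjective_C (u : E) : IsProjectiveInjective (C ⊙ₗ u : E) :=
  ⟨fun _ hp f => hp.2 u f, fun _ hi f => hi.2 u f⟩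

theorem isProjectiveInjective_zero : IsProjectiveInjective (0 : E) :=
  ⟨fun _ _ _ => ⟨0, (isZero_zero E).eq_of_src _ _⟩, fun _ _ _ => ⟨0, (isZero_zero E).eq_of_tgt _ _⟩⟩

theorem IsProjectiveInjective.prop_biprod {q r : E} (hq : IsProjectiveInjective q)
    (hr : IsProjectiveInjective r) : IsProjectiveInjective (q ⊞ r) := by
  refine ⟨fun p hp f => ?_, fun i hi f => ?_⟩
  · obtain ⟨g, hg⟩ := hq.1 p hp (biprod.inl ≫ f)
    obtain ⟨h, hh⟩ := hr.1 p hp (biprod.inr ≫ f)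
    exact ⟨biprod.desc g h, by ext <;> simp [hg, hh]⟩
  · obtain ⟨g, hg⟩ := hq.2 i hi (f ≫ biprod.fst)
    obtain ⟨h, hh⟩ := hr.2 i hi (f ≫ biprod.snd)
    exact ⟨biprod.lift g h, by ext <;> simp [hg, hh]⟩

theorem IsFrobeniusInflation.of_isPushout {x y x' y' : E} {f : x ⟶ x'} {i : x ⟶ y} {i' : x' ⟶ y'}
    {f' : y ⟶ y'} (h : IsFrobeniusInflation i) (sq : IsPushout f i i' f') :
    IsFrobeniusInflation i' := by
  obtain ⟨⟨z, p, w, hi⟩, hu⟩ := h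
  obtain ⟨p', hp', -⟩ := IsConflation.pushout ⟨w, hi⟩ sq
  refine ⟨hp'.isInflation, fun u g => ?_⟩
  obtain ⟨k, hk⟩ := hu u (f ≫ g)
  exact ⟨sq.desc g k hk.symm, sq.inl_desc _ _ _⟩

theorem IsFrobeniusInflation.comp {x y z : E} {i : x ⟶ y} {j : y ⟶ z}
    (hi : IsFrobeniusInflation i) (hj : IsFrobeniusInflation j) :
    IsFrobeniusInflation (i ≫ j) := by
  refine ⟨ExactCategory.comp_inflation _ _ hi.1 hj.1, fun u f => ?_⟩
  obtain ⟨g, rfl⟩ := hi.2 u f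
  obtain ⟨k, rfl⟩ := hj.2 u g
  exact ⟨k, Category.assoc _ _ _⟩

/-! ### Homotopies -/

/-- Maps that factor through a projective-injective object. -/
def IsNull {x y : E} (f : x ⟶ y) : Prop :=
  ∃ q : E, IsProjectiveInjective q ∧ ∃ (a : x ⟶ q) (b : q ⟶ y), f = a ≫ b

namespace IsNull

variable {x y z : E}

theorem of_C {u : E} (a : x ⟶ C ⊙ₗ u) (b : C ⊙ₗ u ⟶ y) : IsNull (a ≫ b) :=
  ⟨_, isProjectiveInjective_C u, a, b, rfl⟩

theorem zero : IsNull (0 : x ⟶ y) :=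
  ⟨0, isProjectiveInjective_zero, 0, 0, by simp⟩

theorem add {f g : x ⟶ y} (hf : IsNull f) (hg : IsNull g) : IsNull (f + g) := by
  obtain ⟨q, hq, a, b, rfl⟩ := hf
  obtain ⟨r, hr, c, d, rfl⟩ := hg
  exact ⟨q ⊞ r, hq.prop_biprod hr, biprod.lift a c, biprod.desc b d, by simp⟩

theorem comp_right {f : x ⟶ y} (hf : IsNull f) (g : y ⟶ z) : IsNull (f ≫ g) := by
  obtain ⟨q, hq, a, b, rfl⟩ := hf
  exact ⟨q, hq, a, b ≫ g, by simp⟩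

theorem comp_left {g : y ⟶ z} (hg : IsNull g) (f : x ⟶ y) : IsNull (f ≫ g) := by
  obtain ⟨q, hq, a, b, rfl⟩ := hg
  exact ⟨q, hq, f ≫ a, b, by simp⟩

theorem neg {f : x ⟶ y} (hf : IsNull f) : IsNull (-f) := by
  obtain ⟨q, hq, a, b, rfl⟩ := hf
  exact ⟨q, hq, -a, b, by simp⟩

/-- A null map factors through `x ⟶ C ⊗ x`. -/
theorem exists_fac {f : x ⟶ y} (hf : IsNull f) : ∃ h : C ⊙ₗ x ⟶ y, toC x ≫ h = f := by
  obtain ⟨q, hq, a, b, rfl⟩ := hf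
  obtain ⟨g, hg⟩ := hq.2 (toC x) (isFrobeniusInflation_toC x) a
  exact ⟨g ≫ b, by rw [← Category.assoc, hg]⟩

end IsNull

theorem isNull_actionHomLeft {a b : ChbZ} (f : a ⟶ b) (H : Homotopy f.hom 0) (x : E) :
    IsNull (f ⊵ₗ x) := by
  obtain ⟨g, hg⟩ := exists_contract f H
  have : f ⊵ₗ x = toC (a ⊙ₗ x) ≫ (αₗ C a x).inv ≫ g ⊵ₗ x := by
    rw [toC_action, Category.assoc, Iso.hom_inv_id_assoc, ← comp_actionHomLeft, Category.assoc, hg]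
  rw [this]
  exact IsNull.of_C _ _

theorem homotopyEquivalences_of_isIso {x y : E} (f : x ⟶ y) [IsIso f] :
    homotopyEquivalences E f :=
  ⟨inv f, by change IsNull _; rw [IsIso.hom_inv_id, sub_self]; exact IsNull.zero,
    by change IsNull _; rw [IsIso.inv_hom_id, sub_self]; exact IsNull.zero⟩

theorem homotopyEquivalences_actionHomLeft {a b : ChbZ} (f : a ⟶ b)
    (hf : chHomotopyEquivalences f) (x : E) : homotopyEquivalences E (f ⊵ₗ x) := by
  obtain ⟨e, he⟩ := hf
  refine ⟨(ObjectProperty.homMk e.inv : b ⟶ a) ⊵ₗ x, ?_, ?_⟩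
  · change IsNull _
    rw [← comp_actionHomLeft, ← id_actionHomLeft, ← actionHomLeft_sub]
    refine isNull_actionHomLeft _ ?_ x
    have := Homotopy.equivSubZero e.homotopyHomInvId
    rw [he] at this
    exact this
  · change IsNull _
    rw [← comp_actionHomLeft, ← id_actionHomLeft, ← actionHomLeft_sub]
    refine isNull_actionHomLeft _ ?_ x
    have := Homotopy.equivSubZero e.homotopyInvHomId
    rw [he] at this
    exact this

theorem homotopyEquivalences_of_isNull_id {x y : E} (hx : IsNull (𝟙 x)) (hy : IsNull (𝟙 y))
    (f : x ⟶ y) : homotopyEquivalences E f :=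
  ⟨0, by change IsNull _; rw [comp_zero, zero_sub]; exact hx.neg,
    by change IsNull _; rw [zero_comp, zero_sub]; exact hy.neg⟩

theorem isNull_id_C (u : E) : IsNull (𝟙 (C ⊙ₗ u : E)) := by
  simpa using IsNull.of_C (𝟙 (C ⊙ₗ u : E)) (𝟙 _)

/-- Pushouts along Frobenius inflations into projective-injective objects are homotopy
equivalent. -/
theorem exists_homotopyEquivalence_of_isPushout {y z I I' P P' : E} {g : y ⟶ z} {j : y ⟶ I}
    {j' : y ⟶ I'} {a : z ⟶ P} {b : I ⟶ P} {a' : z ⟶ P'} {b' : I' ⟶ P'} (sq : IsPushout g j a b)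
    (sq' : IsPushout g j' a' b') (hj : IsFrobeniusInflation j) (hj' : IsFrobeniusInflation j')
    (hI : IsProjectiveInjective I) (hI' : IsProjectiveInjective I') :
    ∃ e : P ⟶ P', homotopyEquivalences E e := by
  obtain ⟨u, hu⟩ := hI'.2 j hj j'
  obtain ⟨v, hv⟩ := hI.2 j' hj' j
  have w : g ≫ a' = j ≫ u ≫ b' := by rw [sq'.w, reassoc_of% hu]
  have w' : g ≫ a = j' ≫ v ≫ b := by rw [sq.w, reassoc_of% hv]
  have w₁ : g ≫ 0 = j ≫ (u ≫ v - 𝟙 I) := by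
    rw [comp_zero, Preadditive.comp_sub, reassoc_of% hu, hv, Category.comp_id, sub_self]
  have w₂ : g ≫ 0 = j' ≫ (v ≫ u - 𝟙 I') := by
    rw [comp_zero, Preadditive.comp_sub, reassoc_of% hv, hu, Category.comp_id, sub_self]
  refine ⟨sq.desc a' (u ≫ b') w, sq'.desc a (v ≫ b) w',
    ⟨I, hI, sq.desc 0 (u ≫ v - 𝟙 I) w₁, b, sq.hom_ext ?_ ?_⟩,
    ⟨I', hI', sq'.desc 0 (v ≫ u - 𝟙 I') w₂, b', sq'.hom_ext ?_ ?_⟩⟩ <;>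
  simp

/-! ### Cones -/

/-- The inclusion of the target in the cone. -/
def coneInl {x y : E} (f : x ⟶ y) : y ⟶ cone f := pushout.inl _ _

/-- The map from `C ⊗ x` to the cone. -/
def coneInr {x y : E} (f : x ⟶ y) : C ⊙ₗ x ⟶ cone f := pushout.inr _ _

theorem isPushout_cone {x y : E} (f : x ⟶ y) :
    IsPushout f (toC x) (coneInl f) (coneInr f) :=
  IsPushout.of_hasPushout f (toC x)

theorem isFrobeniusInflation_coneInl {x y : E} (f : x ⟶ y) : IsFrobeniusInflation (coneInl f) :=
  (isFrobeniusInflation_toC x).of_isPushout (isPushout_cone f)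

theorem exists_isConflation_coneInl {x y : E} (f : x ⟶ y) :
    ∃ p : cone f ⟶ T ⊙ₗ x, IsConflation (coneInl f) p ∧ coneInr f ≫ p = cToT ⊵ₗ x :=
  (isConflation_toC x).pushout (isPushout_cone f)

/-- The cone of an inflation differs from the cokernel only by the contractible object Cx. -/
theorem IsConflation.exists_isConflation_coneInr {x y z : E} {i : x ⟶ y} {p : y ⟶ z}
    (h : IsConflation i p) : ∃ p' : cone i ⟶ z, IsConflation (coneInr i) p' ∧
      coneInl i ≫ p' = p :=
  h.pushout (isPushout_cone i).flip

/-- The map between the cones given by a commutative square. -/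
def coneMap {x y x' y' : E} {f : x ⟶ y} {f' : x' ⟶ y'} (a : x ⟶ x') (b : y ⟶ y')
    (w : f ≫ b = a ≫ f') : cone f ⟶ cone f' :=
  (isPushout_cone f).desc (b ≫ coneInl f') (C ⊴ₗ a ≫ coneInr f') (by
    rw [reassoc_of% w, (isPushout_cone f').w, ← Category.assoc, ← Category.assoc, toC_naturality])

theorem coneInl_coneMap {x y x' y' : E} {f : x ⟶ y} {f' : x' ⟶ y'} (a : x ⟶ x') (b : y ⟶ y')
    (w : f ≫ b = a ≫ f') :
    coneInl f ≫ coneMap a b w = b ≫ coneInl f' :=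
  (isPushout_cone f).inl_desc _ _ _

theorem coneInl_coneMap_assoc {x y x' y' : E} {f : x ⟶ y} {f' : x' ⟶ y'} (a : x ⟶ x')
    (b : y ⟶ y') (w : f ≫ b = a ≫ f') {t : E} (g : cone f' ⟶ t) :
    coneInl f ≫ coneMap a b w ≫ g = b ≫ coneInl f' ≫ g := by
  rw [← Category.assoc, coneInl_coneMap, Category.assoc]

theorem coneInr_coneMap {x y x' y' : E} {f : x ⟶ y} {f' : x' ⟶ y'} (a : x ⟶ x') (b : y ⟶ y')
    (w : f ≫ b = a ≫ f') : coneInr f ≫ coneMap a b w = C ⊴ₗ a ≫ coneInr f' :=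
  (isPushout_cone f).inr_desc _ _ _

theorem coneInr_coneMap_assoc {x y x' y' : E} {f : x ⟶ y} {f' : x' ⟶ y'} (a : x ⟶ x')
    (b : y ⟶ y') (w : f ≫ b = a ≫ f') {t : E} (g : cone f' ⟶ t) :
    coneInr f ≫ coneMap a b w ≫ g = C ⊴ₗ a ≫ coneInr f' ≫ g := by
  rw [← Category.assoc, coneInr_coneMap, Category.assoc]

theorem coneMap_comp {x y x' y' x'' y'' : E} {f : x ⟶ y} {f' : x' ⟶ y'} {f'' : x'' ⟶ y''}
    (a : x ⟶ x') (b : y ⟶ y') (w : f ≫ b = a ≫ f') (a' : x' ⟶ x'') (b' : y' ⟶ y'')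
    (w' : f' ≫ b' = a' ≫ f'') :
    coneMap a b w ≫ coneMap a' b' w' =
      coneMap (a ≫ a') (b ≫ b') (by rw [reassoc_of% w, w', Category.assoc]) := by
  refine (isPushout_cone f).hom_ext ?_ ?_
  · simp only [coneInl_coneMap, coneInl_coneMap_assoc, Category.assoc]
  · simp only [coneInr_coneMap, coneInr_coneMap_assoc, actionHomRight_comp, Category.assoc]

theorem coneMap_id {x y : E} (f : x ⟶ y) :
    coneMap (f := f) (f' := f) (𝟙 x) (𝟙 y) (by simp) = 𝟙 _ := by
  refine (isPushout_cone f).hom_ext ?_ ?_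
  · simp [coneInl_coneMap]
  · simp [coneInr_coneMap]

/-- The cone of a composition is a pushout of the cone of the first map. -/
theorem isPushout_coneMap {x y z : E} (f : x ⟶ y) (g : y ⟶ z) (h : x ⟶ z) (w : f ≫ g = 𝟙 x ≫ h) :
    IsPushout g (coneInl f) (coneInl h) (coneMap (𝟙 x) g w) := by
  refine IsPushout.of_left (h₁₁ := f) (v₁₁ := toC x) (h₂₁ := coneInr f) ?_
    (coneInl_coneMap _ _ _).symm (isPushout_cone f)
  rw [coneInr_coneMap, actionHomRight_id, Category.id_comp, w, Category.id_comp]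
  exact isPushout_cone h

/-- The map from the cone of `i : x ⟶ y` to `C ⊗ y`. -/
def coneToC {x y : E} (i : x ⟶ y) : cone i ⟶ C ⊙ₗ y :=
  (isPushout_cone i).desc (toC y) (C ⊴ₗ i) (toC_naturality i).symm

theorem coneInl_coneToC {x y : E} (i : x ⟶ y) : coneInl i ≫ coneToC i = toC y :=
  (isPushout_cone i).inl_desc _ _ _

theorem coneInl_coneToC_assoc {x y : E} (i : x ⟶ y) {t : E} (g : C ⊙ₗ y ⟶ t) :
    coneInl i ≫ coneToC i ≫ g = toC y ≫ g := by
  rw [← Category.assoc, coneInl_coneToC]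

theorem coneInr_coneToC {x y : E} (i : x ⟶ y) : coneInr i ≫ coneToC i = C ⊴ₗ i :=
  (isPushout_cone i).inr_desc _ _ _

theorem coneInr_coneToC_assoc {x y : E} (i : x ⟶ y) {t : E} (g : C ⊙ₗ y ⟶ t) :
    coneInr i ≫ coneToC i ≫ g = C ⊴ₗ i ≫ g := by
  rw [← Category.assoc, coneInr_coneToC]

/-- The pullback of Cy → Ty along Tx → Ty is the kernel of the deflation Cy → Ty → Tz. Both this
pullback and Cone(i) are extensions of Tx by y, so the short five lemma identifies them. -/
theorem IsConflation.isInflation_coneToC {x y z : E} {i : x ⟶ y} {p : y ⟶ z}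
    (h : IsConflation i p) : IsInflation (coneToC i) := by
  have hT := h.action T
  have := hT.mono
  obtain ⟨K, k, q, sq, -⟩ := ExactCategory.pullback_deflation (cToT ⊵ₗ y) (T ⊴ₗ i)
    (isConflation_toC y).isDeflation
  obtain ⟨m, hm, hmk⟩ := (isConflation_toC y).pullback sq
  obtain ⟨r, hr, hr'⟩ := exists_isConflation_coneInl i
  have : Mono k := ⟨fun a b hab => sq.hom_ext hab (by
    rw [← cancel_mono (T ⊴ₗ i), Category.assoc, Category.assoc, ← sq.w, reassoc_of% hab])⟩
  have hk : IsConflation k (cToT ⊵ₗ y ≫ T ⊴ₗ p) := by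
    refine .of_isDeflation (ExactCategory.comp_deflation _ _ (isConflation_toC y).isDeflation
      hT.isDeflation) ?_ (fun f hf => ?_)
    · rw [reassoc_of% sq.w, hT.zero, comp_zero]
    · obtain ⟨g, hg⟩ := hT.exists_lift (f ≫ cToT ⊵ₗ y) (by rw [Category.assoc, hf])
      exact ⟨sq.lift f g hg.symm, sq.lift_fst _ _ _⟩
  have w : coneToC i ≫ cToT ⊵ₗ y = r ≫ T ⊴ₗ i := by
    refine (isPushout_cone i).hom_ext ?_ ?_
    · rw [coneInl_coneToC_assoc, reassoc_of% hr.zero, (isConflation_toC y).zero, zero_comp]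
    · rw [coneInr_coneToC_assoc, reassoc_of% hr', action_exchange]
  have : IsIso (sq.lift _ _ w) := hr.isIso_of_comp hm _
    (sq.hom_ext (by rw [Category.assoc, sq.lift_fst, coneInl_coneToC, hmk])
      (by rw [Category.assoc, sq.lift_snd, hr.zero, hm.zero])) (sq.lift_snd _ _ w)
  exact (hk.of_iso (i' := coneToC i) (asIso (sq.lift _ _ w)).symm (Iso.refl _) (Iso.refl _)
    (by simp) (Category.id_comp _ |>.trans (Category.comp_id _).symm)).isInflation

/-- A morphism of conflations induces a conflation of cones. -/
theorem IsConflation.coneMap {x y z x' y' z' : E} {i : x ⟶ y} {p : y ⟶ z} {i' : x' ⟶ y'}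
    {p' : y' ⟶ z'} (h : IsConflation i p) (h' : IsConflation i' p') {a : x ⟶ x'} {b : y ⟶ y'}
    {c : z ⟶ z'} (w₁ : a ≫ i' = i ≫ b) (w₂ : b ≫ p' = p ≫ c) :
    IsConflation (Complicial.coneMap i i' w₁) (Complicial.coneMap p p' w₂) := by
  have hC := h.action C
  have := hC.epi
  have := h'.epi
  -- Cone(a) → Cone(b) factors through the cone of `a ≫ i'`. The first factor is a pushout of `i'`,
  -- the second, by this square, a pushout of `coneToC i`; hence both are inflations.
  have sq : IsPushout (coneToC i) (Complicial.coneMap (𝟙 x) b (by rw [Category.id_comp, w₁]))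
      (coneInr b) (Complicial.coneMap (f := a ≫ i') i (𝟙 y') (by rw [Category.comp_id, w₁])) := by
    refine IsPushout.of_left (h₁₁ := coneInl i) (v₁₁ := b) (h₂₁ := coneInl (a ≫ i')) ?_ ?_
      (isPushout_coneMap _ _ _ _).flip
    · rw [coneInl_coneToC, coneInl_coneMap, Category.id_comp]
      exact (isPushout_cone b).flip
    · refine (isPushout_cone i).hom_ext ?_ ?_
      · rw [coneInl_coneToC_assoc, coneInl_coneMap_assoc, coneInl_coneMap, Category.id_comp,
          (isPushout_cone b).w]
      · rw [coneInr_coneToC_assoc, coneInr_coneMap_assoc, coneInr_coneMap, actionHomRight_id,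
          Category.id_comp]
  obtain ⟨q, hq⟩ : IsInflation (Complicial.coneMap i i' w₁) := by
    obtain ⟨_, _, _, hi⟩ := h.isInflation_coneToC
    obtain ⟨_, h₁, -⟩ := IsConflation.pushout ⟨_, hi⟩ sq.flip
    obtain ⟨_, h₂, -⟩ := h'.pushout (isPushout_coneMap a i' (a ≫ i') (by simp)).flip
    have := ExactCategory.comp_inflation _ _ h₂.isInflation h₁.isInflation
    rw [coneMap_comp] at this
    simp only [Category.id_comp, Category.comp_id] at this
    exact this
  have : Epi (Complicial.coneMap p p' w₂) := ⟨fun u v huv => by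
    refine (isPushout_cone c).hom_ext ?_ ?_
    · have := coneInl b ≫= huv
      rw [coneInl_coneMap_assoc, coneInl_coneMap_assoc] at this
      exact (cancel_epi p').1 this
    · have := coneInr b ≫= huv
      rw [coneInr_coneMap_assoc, coneInr_coneMap_assoc] at this
      exact (cancel_epi (C ⊴ₗ p)).1 this⟩
  refine .of_isInflation ⟨q, hq⟩ ?_ (fun {t} f hf => ?_)
  · refine (isPushout_cone a).hom_ext ?_ ?_
    · rw [coneInl_coneMap_assoc, coneInl_coneMap, reassoc_of% h'.zero, zero_comp, comp_zero]
    · rw [coneInr_coneMap_assoc, coneInr_coneMap, reassoc_of% hC.zero, zero_comp, comp_zero]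
  · obtain ⟨u, hu⟩ := h'.exists_desc (coneInl b ≫ f) (by
      rw [← coneInl_coneMap_assoc _ _ w₁, hf, comp_zero])
    obtain ⟨v, hv⟩ := hC.exists_desc (coneInr b ≫ f) (by
      rw [← coneInr_coneMap_assoc _ _ w₁, hf, comp_zero])
    have := h.epi
    refine ⟨(isPushout_cone c).desc u v ?_, (isPushout_cone b).hom_ext ?_ ?_⟩
    · rw [← cancel_epi p, ← reassoc_of% w₂, hu, reassoc_of% (isPushout_cone b).w,
        ← reassoc_of% (toC_naturality p), hv]
    · rw [coneInl_coneMap_assoc, IsPushout.inl_desc, hu]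
    · rw [coneInr_coneMap_assoc, IsPushout.inr_desc, hv]

end

/-! ### Cones of homotopy equivalences -/

section

variable {E : Type*} [Category E] [Preadditive E] [HasZeroObject E] [HasBinaryBiproducts E]
  [ExactCategory E] [ComplicialExactCategory E]

/-- The composite `f ≫ coneInl f` factors through Cx; precomposing with a homotopy inverse of `f`
recovers `coneInl f` up to a null map. -/
theorem isNull_coneInl {x y : E} {f : x ⟶ y} (hf : homotopyEquivalences E f) :
    IsNull (coneInl f) := by
  obtain ⟨g, -, hg⟩ := hf
  have h₁ : IsNull (g ≫ f ≫ coneInl f) := by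
    rw [(isPushout_cone f).w, ← Category.assoc]
    exact IsNull.of_C _ _
  have h₂ : IsNull ((g ≫ f - 𝟙 y) ≫ coneInl f) := IsNull.comp_right hg _
  have h₃ := h₁.add h₂.neg
  rwa [Preadditive.sub_comp, Category.assoc, Category.id_comp, neg_sub, add_sub_cancel] at h₃

/-- The cone of a homotopy equivalence is contractible. -/
theorem isNull_id_cone {x y : E} {f : x ⟶ y} (hf : homotopyEquivalences E f) :
    IsNull (𝟙 (cone f)) := by
  have hc := IsConflation.lift_desc (isInflation_toC x) (isPushout_cone f)
  have := hc.epi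
  have hn := isNull_coneInl hf
  obtain ⟨g, hg, -⟩ := hf
  obtain ⟨h, hh⟩ := IsNull.exists_fac hg
  -- The homotopy `h` from `f ≫ g` to the identity makes (g, -h) a retraction of x → y ⊕ Cx, so the
  -- conflation splits. Via the section `s`, the identity of the cone is a sum of maps through
  -- `coneInl f` and `coneInr f`, both null.
  obtain ⟨s, hs⟩ := hc.exists_desc (𝟙 _ - biprod.desc g (-h) ≫ biprod.lift f (toC x)) (by
    have : biprod.lift f (toC x) ≫ biprod.desc g (-h) = 𝟙 x := by simp [hh]
    rw [Preadditive.comp_sub, reassoc_of% this, Category.comp_id, sub_self])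
  have hsp : s ≫ biprod.desc (coneInl f) (-coneInr f) = 𝟙 _ := by
    rw [← cancel_epi (biprod.desc (coneInl f) (-coneInr f)), reassoc_of% hs, Preadditive.sub_comp,
      Category.assoc, hc.zero, comp_zero, sub_zero, Category.id_comp, Category.comp_id]
  rw [← hsp, biprod.desc_eq, Preadditive.comp_add]
  refine IsNull.add ?_ ?_
  · rw [← Category.assoc]; exact hn.comp_left _
  · rw [← Category.assoc]; exact IsNull.of_C _ _

/-! ### Null classes -/

namespace IsNullClass

variable {N : ObjectProperty E}

theorem ext (hN : IsNullClass N) {x y z : E} {i : x ⟶ y} {p : y ⟶ z} (h : IsConflation i p)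
    (hx : N x) (hz : N z) :
    N y :=
  hN.extension h.2 hx hz

theorem of_isNull_id (hN : IsNullClass N) {x : E} (hx : IsNull (𝟙 x)) : N x :=
  hN.homotopyEquivalent 0 (homotopyEquivalences_of_isNull_id (x := (0 : E))
    (by rw [(isZero_zero E).eq_of_src (𝟙 _) 0]; exact IsNull.zero) hx 0) hN.zero

theorem prop_C (hN : IsNullClass N) (u : E) : N (C ⊙ₗ u) := hN.of_isNull_id (isNull_id_C u)

theorem of_T (hN : IsNullClass N) {x : E} (h : N (T ⊙ₗ x)) : N x := by
  obtain ⟨i, p, hip⟩ := exists_retract_shifts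
  refine hN.retract ((λₗ[ChbZ] x).inv ≫ i ⊵ₗ x ≫ (αₗ TInv T x).hom)
    ((αₗ TInv T x).inv ≫ p ⊵ₗ x ≫ (λₗ[ChbZ] x).hom) ?_ (hN.tensor TInv h)
  rw [Category.assoc, Category.assoc, Iso.hom_inv_id_assoc, ← comp_actionHomLeft_assoc, hip,
    id_actionHomLeft, Category.id_comp, Iso.inv_hom_id]

theorem cone_of_isConflation (hN : IsNullClass N) {x y z : E} {i : x ⟶ y} {p : y ⟶ z}
    (h : IsConflation i p)
    (hz : N z) : coneIn N i := by
  obtain ⟨p', h', -⟩ := h.exists_isConflation_coneInr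
  exact hN.ext h' (hN.prop_C x) hz

/-- As a pushout of `i`, the map Cx → Cone(i) is a Frobenius inflation, so it splits. Hence `z` is a
retract of Cone(i), which is an extension of Tx by `y`. -/
theorem third (hN : IsNullClass N) {x y z : E} {i : x ⟶ y} {p : y ⟶ z} (h : IsConflation i p)
    (hi : IsFrobeniusInflation i) (hx : N x) (hy : N y) : N z := by
  obtain ⟨p', h', -⟩ := h.exists_isConflation_coneInr
  obtain ⟨q, hq, -⟩ := exists_isConflation_coneInl i
  have := h'.epi
  obtain ⟨r, hr⟩ := (hi.of_isPushout (isPushout_cone i).flip).2 x (𝟙 _)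
  obtain ⟨s, hs⟩ := h'.exists_desc (𝟙 _ - r ≫ coneInr i) (by
    rw [Preadditive.comp_sub, reassoc_of% hr, Category.comp_id, sub_self])
  refine hN.retract s p' ?_ (hN.ext hq hy (hN.tensor T hx))
  rw [← cancel_epi p', reassoc_of% hs, Preadditive.sub_comp, Category.assoc, h'.zero, comp_zero,
    sub_zero, Category.id_comp, Category.comp_id]

/-- Here `i` need not be Frobenius: `third` is applied to the rotated conflation y → Cone(i) → Tx,
whose inflation always is, and then the shift is undone. -/
theorem first (hN : IsNullClass N) {x y z : E} {i : x ⟶ y} {p : y ⟶ z} (h : IsConflation i p)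
    (hy : N y) (hz : N z) :
    N x := by
  obtain ⟨q, hq, -⟩ := exists_isConflation_coneInl i
  exact hN.of_T (hN.third hq (isFrobeniusInflation_coneInl i) hy (hN.cone_of_isConflation h hz))

theorem prop_of_homotopyEquivalences (hN : IsNullClass N) {x y : E} {f : x ⟶ y}
    (hf : homotopyEquivalences E f) :
    N x ↔ N y := by
  refine ⟨hN.homotopyEquivalent f hf, ?_⟩
  obtain ⟨g, h₁, h₂⟩ := hf
  exact hN.homotopyEquivalent g ⟨f, h₂, h₁⟩

theorem prop_biprod_C (hN : IsNullClass N) {x u : E} : N (x ⊞ C ⊙ₗ u) ↔ N x :=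
  ⟨hN.retract biprod.inl biprod.fst (by simp), fun h => hN.biprod h (hN.prop_C u)⟩

/-- The octahedral axiom: the three cones of a composition form a conflation up to homotopy. -/
theorem exists_octahedron (hN : IsNullClass N) {x y z : E} (f : x ⟶ y) (g : y ⟶ z) :
    ∃ (u v : E) (i : cone f ⟶ u) (p : u ⟶ v), IsConflation i p ∧ IsFrobeniusInflation i ∧
      (N u ↔ N (cone (f ≫ g))) ∧ (N v ↔ N (cone g)) := by
  let k := coneMap (f := f) (f' := f ≫ g) (𝟙 x) g (by simp)
  -- The pasted square presents Cone(k) as the pushout of `g` along a Frobenius inflation of `y`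
  -- into the projective-injective C(Cone(f)). Cone(g) is the same with Cy in its place, so the two
  -- are homotopy equivalent.
  have sq := (isPushout_coneMap f g (f ≫ g) (by simp)).paste_vert (isPushout_cone k)
  obtain ⟨e, he⟩ := exists_homotopyEquivalence_of_isPushout sq (isPushout_cone g)
    ((isFrobeniusInflation_coneInl f).comp (isFrobeniusInflation_toC _))
    (isFrobeniusInflation_toC y) (isProjectiveInjective_C _) (isProjectiveInjective_C _)
  have hc := IsConflation.lift_desc (isInflation_toC _) (isPushout_cone k)
  refine ⟨_, _, _, _, hc, ⟨hc.isInflation, fun u m => ?_⟩, hN.prop_biprod_C,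
    hN.prop_of_homotopyEquivalences he⟩
  obtain ⟨n, hn⟩ := (isFrobeniusInflation_toC _).2 u m
  exact ⟨biprod.snd ≫ n, by rw [biprod.lift_snd_assoc, hn]⟩

theorem hasTwoOutOfThreeProperty (hN : IsNullClass N) : (coneIn N).HasTwoOutOfThreeProperty where
  comp_mem f g hf hg := by
    obtain ⟨u, v, i, p, h, hi, hu, hv⟩ := hN.exists_octahedron f g
    exact hu.1 (hN.ext h hf (hv.2 hg))
  of_postcomp f g hg hfg := by
    obtain ⟨u, v, i, p, h, hi, hu, hv⟩ := hN.exists_octahedron f g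
    exact hN.first h (hu.2 hfg) (hv.2 hg)
  of_precomp f g hf hfg := by
    obtain ⟨u, v, i, p, h, hi, hu, hv⟩ := hN.exists_octahedron f g
    exact hv.1 (hN.third h hi hf (hu.2 hfg))

theorem homotopyEquivalences_le_coneIn (hN : IsNullClass N) : homotopyEquivalences E ≤ coneIn N :=
  fun _ _ _ hf => hN.of_isNull_id (isNull_id_cone hf)

/-- Factoring `g` as x → y ⊕ Cx → y avoids comparing a ⊗ Cone(g) with the cone of a ⊗ g: the first
factor becomes an inflation with cokernel a ⊗ Cone(g), and two-out-of-three handles the projection.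
-/
theorem coneIn_actionHomRight (hN : IsNullClass N) (a : ChbZ) {x y : E} {g : x ⟶ y}
    (hg : coneIn N g) :
    coneIn N (a ⊴ₗ g) := by
  have := hN.hasTwoOutOfThreeProperty
  have h₁ : coneIn N (a ⊴ₗ biprod.lift g (toC x)) :=
    hN.cone_of_isConflation ((IsConflation.lift_desc (isInflation_toC x)
      (isPushout_cone g)).action a) (hN.tensor a hg)
  have h₂ : coneIn N (a ⊴ₗ (biprod.inl : y ⟶ y ⊞ C ⊙ₗ x)) :=
    hN.cone_of_isConflation ((IsConflation.inl_snd y (C ⊙ₗ x)).action a)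
      (hN.tensor a (hN.prop_C x))
  have h₃ : coneIn N (a ⊴ₗ (biprod.fst : y ⊞ C ⊙ₗ x ⟶ y)) := by
    refine (coneIn N).of_precomp _ _ h₂ ?_
    rw [← actionHomRight_comp, biprod.inl_fst]
    exact hN.homotopyEquivalences_le_coneIn _ (homotopyEquivalences_of_isIso _)
  have h₄ := (coneIn N).comp_mem _ _ h₁ h₃
  rwa [← actionHomRight_comp, biprod.lift_fst] at h₄

theorem coneIn_isClassOfWeakEquivalences (hN : IsNullClass N) : IsClassOfWeakEquivalences
    (coneIn N) where
  tensor {a b x y} f g hf hg := by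
    have := hN.hasTwoOutOfThreeProperty
    rw [actionHom_def]
    exact (coneIn N).comp_mem _ _
      (hN.homotopyEquivalences_le_coneIn _ (homotopyEquivalences_actionHomLeft f hf x))
      (hN.coneIn_actionHomRight b hg)
  homotopyEquivalences_le := hN.homotopyEquivalences_le_coneIn
  twoOutOfThree := hN.hasTwoOutOfThreeProperty
  extension φ h h' h₁ h₃ :=
    hN.ext ((IsConflation.of_shortComplex h).coneMap (.of_shortComplex h') φ.comm₁₂ φ.comm₂₃) h₁ h₃
  retract := ⟨fun {X Y Z W f g} h hg => by
    refine hN.retract (coneMap (f := f) (f' := g) h.i.left h.i.right h.i_w.symm)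
      (coneMap h.r.left h.r.right h.r_w.symm) ?_ hg
    rw [coneMap_comp, ← coneMap_id]
    congr 1
    · exact h.retract_left
    · exact h.retract_right⟩

/-- The cone of 0 → x is an extension of T ⊗ 0 by `x`, so `first` and closure under extensions give
the two inclusions. -/
theorem trivialObjects_coneIn (hN : IsNullClass N) : trivialObjects (coneIn N) = N := by
  ext x
  obtain ⟨p, hp, -⟩ := exists_isConflation_coneInl (0 : (0 : E) ⟶ x)
  exact ⟨fun h => hN.first hp h (hN.tensor T hN.zero),
    fun h => hN.ext hp h (hN.tensor T hN.zero)⟩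

end IsNullClass

/-! ### Classes of weak equivalences -/

namespace IsClassOfWeakEquivalences

variable {w : MorphismProperty E}

theorem of_isIso (hw : IsClassOfWeakEquivalences w) {x y : E} (f : x ⟶ y) [IsIso f] : w f :=
  hw.homotopyEquivalences_le _ (homotopyEquivalences_of_isIso f)

theorem of_isZero (hw : IsClassOfWeakEquivalences w) {x y : E} (f : x ⟶ y) (hx : IsZero x)
    (hy : IsZero y) : w f :=
  have : IsIso f := ⟨0, hx.eq_of_src _ _, hy.eq_of_src _ _⟩
  hw.of_isIso f

theorem ext (hw : IsClassOfWeakEquivalences w) {x y z x' y' z' : E} {i : x ⟶ y} {p : y ⟶ z}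
    {i' : x' ⟶ y'} {p' : y' ⟶ z'}
    (h : IsConflation i p) (h' : IsConflation i' p') {a : x ⟶ x'} {b : y ⟶ y'} {c : z ⟶ z'}
    (w₁ : a ≫ i' = i ≫ b) (w₂ : b ≫ p' = p ≫ c) (ha : w a) (hc : w c) : w b :=
  hw.extension (S := ShortComplex.mk i p h.zero) (S' := ShortComplex.mk i' p' h'.zero)
    ⟨a, b, c, w₁, w₂⟩ h.2 h'.2 ha hc

theorem trivialObjects_ext (hw : IsClassOfWeakEquivalences w) {x y z : E} {i : x ⟶ y} {p : y ⟶ z}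
    (h : IsConflation i p)
    (hx : trivialObjects w x) (hz : trivialObjects w z) : trivialObjects w y :=
  hw.ext (IsConflation.id_zero 0 0 (isZero_zero E)) h (by simp) (by simp) hx hz

theorem trivialObjects_iff (hw : IsClassOfWeakEquivalences w) {x y : E} {f : x ⟶ y} (hf : w f) :
    trivialObjects w x ↔ trivialObjects w y := by
  have := hw.twoOutOfThree
  refine ⟨fun h => ?_, fun h => w.of_postcomp 0 f hf ?_⟩
  · have := w.comp_mem _ _ h hf
    rwa [zero_comp] at this
  · rwa [zero_comp]

theorem trivialObjects_isNullClass (hw : IsClassOfWeakEquivalences w) : IsNullClass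
    (trivialObjects w) where
  zero := hw.of_isZero _ (isZero_zero E) (isZero_zero E)
  biprod {x y} hx hy := hw.trivialObjects_ext (IsConflation.inl_snd x y) hx hy
  homotopyEquivalent f hf := (hw.trivialObjects_iff (hw.homotopyEquivalences_le _ hf)).1
  tensor a {x} hx := by
    have h := hw.tensor (𝟙 a) (0 : (0 : E) ⟶ x) ⟨HomotopyEquiv.refl _, rfl⟩ hx
    exact (hw.trivialObjects_iff h).1
      (hw.of_isZero _ (isZero_zero E) (isZero_action a (isZero_zero E)))
  extension h hx hz := hw.trivialObjects_ext (.of_shortComplex h) hx hz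
  retract {x y} i p hip hy := by
    have := hw.retract
    exact w.of_retract (f := (0 : (0 : E) ⟶ x)) (g := (0 : (0 : E) ⟶ y))
      { i := Arrow.homMk (𝟙 _) i (by simp)
        r := Arrow.homMk (𝟙 _) p (by simp)
        retract := by ext <;> simp [hip] } hy

theorem trivialObjects_C (hw : IsClassOfWeakEquivalences w) (u : E) : trivialObjects w
    (C ⊙ₗ u : E) :=
  hw.trivialObjects_isNullClass.prop_C u

theorem coneIn_trivialObjects (hw : IsClassOfWeakEquivalences w) : coneIn
    (trivialObjects w) = w := by
  have := hw.twoOutOfThree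
  ext x y f
  refine ⟨fun h => ?_, fun h => ?_⟩
  · have h₁ : w (biprod.lift f (toC x)) :=
      hw.ext (IsConflation.id_zero x 0 (isZero_zero E))
        (IsConflation.lift_desc (isInflation_toC x) (isPushout_cone f)) (a := 𝟙 x) (c := 0)
        (by simp) (by simp [(isPushout_cone f).w]) (hw.of_isIso _) h
    have h₂ : w (biprod.fst : y ⊞ C ⊙ₗ x ⟶ y) := by
      refine hw.homotopyEquivalences_le _ ⟨biprod.inl, ?_, ?_⟩
      · change IsNull _
        have h : biprod.fst ≫ biprod.inl - 𝟙 (y ⊞ C ⊙ₗ x) = -(biprod.snd ≫ biprod.inr) := by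
          rw [← biprod.total]; abel
        rw [h]
        exact (IsNull.of_C _ _).neg
      · change IsNull _
        rw [biprod.inl_fst, sub_self]
        exact IsNull.zero
    have := w.comp_mem _ _ h₁ h₂
    rwa [biprod.lift_fst] at this
  · obtain ⟨p, hp, hp'⟩ := exists_isConflation_coneInl f
    -- The outer maps of this morphism of conflations are `f` and the identity of Tx.
    have h₁ : w (coneInr f) := hw.ext (isConflation_toC x) hp (c := 𝟙 _) (isPushout_cone f).w
      (by rw [hp', Category.comp_id]) h (hw.of_isIso _)
    exact (hw.trivialObjects_iff h₁).1 (hw.trivialObjects_C x)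

end IsClassOfWeakEquivalences

end

end Complicial

end

theorem mainTheorem4 {E : Type*} [Category E] [Preadditive E]
    [HasZeroObject E] [HasBinaryBiproducts E]
    [Complicial.ExactCategory E] [Complicial.ComplicialExactCategory E] :
    (∀ w : MorphismProperty E, Complicial.IsClassOfWeakEquivalences w →
      Complicial.IsNullClass (Complicial.trivialObjects w)) ∧
    (∀ N : ObjectProperty E, Complicial.IsNullClass N →
      Complicial.IsClassOfWeakEquivalences (Complicial.coneIn N)) ∧
    (∀ w : MorphismProperty E, Complicial.IsClassOfWeakEquivalences w →
      Complicial.coneIn (Complicial.trivialObjects w) = w) ∧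
    (∀ N : ObjectProperty E, Complicial.IsNullClass N →
      Complicial.trivialObjects (Complicial.coneIn N) = N) :=
  ⟨fun _ hw => hw.trivialObjects_isNullClass, fun _ hN => hN.coneIn_isClassOfWeakEquivalences,
    fun _ hw => hw.coneIn_trivialObjects, fun _ hN => hN.trivialObjects_coneIn⟩
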